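/- Let $K$ be a field, $S=K[x_1,\dots,x_n]$ with its $\mathbb Z^n$-grading ($\deg x_i=\mathbf e_i$), and let $\mathbf t\in\mathbb N^n$ with $t_i\ge 1$ for all $i$. Write $\mathbf 1=(1,\dots,1)$, and order $\mathbb Z^n$ componentwise. Let $\mathrm{Mod}_{\mathbb Z^n}S$ be the category of $\mathbb Z^n$-graded $S$-modules and degree-preserving $S$-linear maps. For $\mathbf c\in\mathbb N^n$ with $\mathbf c\ge\mathbf 1$ let $\mathrm{Mod}_{\mathbf c}$ be its full subcategory of positively $\mathbf c$-determined modules: finitely generated modules $M$ with $M_{\mathbf a}=0$ for $\mathbf a\notin\mathbb N^n$, such that multiplication by $x_i$ is a bijection $M_{\mathbf a}\to M_{\mathbf a+\mathbf e_i}$ whenever $a_i\ge c_i$. For $\mathbf a\in\mathbb Z^n$ let $M(\mathbf a)$ be the module $M$ with the grading $M(\mathbf a)_{\mathbf b}=M_{\mathbf a+\mathbf b}$. Define: * the contravariant functor $\mathcal D_{\mathbf c}(M)=\bigl(\bigoplus_{\mathbf a\in\mathbb Z^n}\mathrm{Hom}_{\mathrm{Mod}_{\mathbb Z^n}S}(M,S(\mathbf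 a))\bigr)(-\mathbf c)$, that is, the graded $\mathrm{Hom}$ module $\underline{\mathrm{Hom}}_S(M,S)$ shifted by $-\mathbf c$; * the truncation $\tau_{\mathbf 0}(M)=\bigoplus_{\mathbf b\ge\mathbf 0}M_{\mathbf b}$; * for an order-preserving map $q:\mathbb N^n\to\mathbb Z^n$, the functor $q^*$ with $(q^*M)_{\mathbf b}=M_{q(\mathbf b)}$ for $\mathbf b\in\mathbb N^n$ and $(q^*M)_{\mathbf b}=0$ otherwise, where $x^{\mathbf a}$ acts on $(q^*M)_{\mathbf b}$, $\mathbf b\in\mathbb N^n$, as multiplication by $x^{q(\mathbf a+\mathbf b)-q(\mathbf b)}$ on $M_{q(\mathbf b)}$, and where $(q^*f)_{\mathbf b}=f_{q(\mathbf b)}$; * the maps $r,s:\mathbb N^n\to\mathbb Z^n$ with $r(\mathbf a)_i=t_i$ if $a_i>0$ and $r(\mathbf a)_i=0$ if $a_i=0$, and with $s(\mathbf a)_i=t_i$ if $a_i\ge 1$ and $s(\mathbf a)_i=t_i-1$ if $a_i=0$. Then $\tau_{\mathbf 0}\circ\mathcal D_{\mathbf 1}$, $\mathcal D_{\mathbf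 1}\circ r^*$, $r^*\circ\mathcal D_{\mathbf t}$ and $\mathcal D_{\mathbf 1}\circ s^*$ map $\mathrm{Mod}_{\mathbf t}$ into $\mathrm{Mod}_{\mathbf 1}$, and there are natural isomorphisms of contravariant functors $\mathrm{Mod}_{\mathbf t}\to\mathrm{Mod}_{\mathbf 1}$ $$\text{(1)}\quad \tau_{\mathbf 0}\circ\mathcal D_{\mathbf 1}\cong\mathcal D_{\mathbf 1}\circ r^*,\qquad\qquad \text{(2)}\quad r^*\circ\mathcal D_{\mathbf t}\cong\mathcal D_{\mathbf 1}\circ s^*.$$ -/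

import Mathlib

open CategoryTheory

universe u

namespace MultiGr

/-- The degree group `ℤⁿ`, with its componentwise partial order. -/
abbrev Deg (n : ℕ) : Type := Fin n → ℤ

/-- The polynomial ring `S = K[x₁, …, xₙ]`. -/
abbrev Pol (K : Type u) [Field K] (n : ℕ) : Type u := MvPolynomial (Fin n) K

/-- The degree of the variable `x_i` is the `i`-th unit vector. -/
def varDeg (n : ℕ) : Fin n → Deg n := fun i => Pi.single i 1

/-- The component `S_a` of the fine (`ℤⁿ`-)grading of `S`. -/
abbrev polDeg (K : Type u) [Field K] (n : ℕ) (a : Deg n) : Submodule K (Pol K n) :=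
  MvPolynomial.weightedHomogeneousSubmodule K (varDeg n) a

/-- The monomial `x^d` for `d ∈ ℤⁿ`; only used for `d ≥ 0`. -/
noncomputable def mono (K : Type u) [Field K] {n : ℕ} (d : Deg n) : Pol K n :=
  MvPolynomial.monomial (Finsupp.equivFunOnFinite.symm fun i => (d i).toNat) 1

section mono
variable (K : Type u) [Field K] {n : ℕ}

theorem mono_zero : mono K (0 : Deg n) = 1 := by
  have : (Finsupp.equivFunOnFinite.symm fun i : Fin n => ((0 : Deg n) i).toNat) = 0 := by
    ext i; simp
  rw [mono, this]; rfl

theorem mono_add {d e : Deg n} (hd : 0 ≤ d) (he : 0 ≤ e) :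
    mono K (d + e) = mono K d * mono K e := by
  simp only [mono, MvPolynomial.monomial_mul, one_mul]
  congr 2
  ext i
  simpa using Int.toNat_add (hd i) (he i)

theorem weight_varDeg (m : Fin n →₀ ℕ) :
    Finsupp.weight (varDeg n) m = fun i => (m i : ℤ) := by
  funext i
  rw [Finsupp.weight_apply, Finsupp.sum_fintype _ _ (by simp)]
  simp [varDeg, Finset.sum_apply, Pi.single_apply]

theorem mono_mem {d : Deg n} (hd : 0 ≤ d) : mono K d ∈ polDeg K n d := by
  apply MvPolynomial.isWeightedHomogeneous_monomial
  rw [weight_varDeg]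
  funext i
  simpa using hd i

end mono

/-- A `ℤⁿ`-graded module over `S = K[x₁, …, xₙ]`: an `S`-module `M` with a decomposition
`M = ⨁ M_a` into `K`-subspaces such that `S_a M_b ⊆ M_{a + b}`. -/
structure GrMod (K : Type u) [Field K] (n : ℕ) : Type (u + 1) where
  carrier : Type u
  [addCommGroup : AddCommGroup carrier]
  [modK : Module K carrier]
  [modS : Module (Pol K n) carrier]
  [tower : IsScalarTower K (Pol K n) carrier]
  deg : Deg n → Submodule K carrier
  isInternal : DirectSum.IsInternal deg
  smul_mem : ∀ {a b : Deg n} {p : Pol K n} {x : carrier},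
    p ∈ polDeg K n a → x ∈ deg b → p • x ∈ deg (a + b)

attribute [instance] GrMod.addCommGroup GrMod.modK GrMod.modS GrMod.tower

namespace GrMod
variable {K : Type u} [Field K] {n : ℕ}

/-- Morphisms are the `S`-linear maps that preserve degrees. -/
@[ext]
structure Hom (M N : GrMod K n) : Type u where
  lin : M.carrier →ₗ[Pol K n] N.carrier
  map_mem : ∀ {a : Deg n} {x : M.carrier}, x ∈ M.deg a → lin x ∈ N.deg a

noncomputable instance : Category (GrMod K n) where
  Hom M N := Hom M N
  id M := ⟨LinearMap.id, fun h => h⟩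
  comp f g := ⟨g.lin ∘ₗ f.lin, fun h => g.map_mem (f.map_mem h)⟩

@[simp] theorem id_lin (M : GrMod K n) : Hom.lin (𝟙 M) = LinearMap.id := rfl

@[simp] theorem comp_lin {M N P : GrMod K n} (f : M ⟶ N) (g : N ⟶ P) :
    Hom.lin (f ≫ g) = Hom.lin g ∘ₗ Hom.lin f := rfl

@[ext]
theorem hom_ext {M N : GrMod K n} {f g : M ⟶ N} (h : Hom.lin f = Hom.lin g) : f = g :=
  Hom.ext h

theorem mono_smul_mem (M : GrMod K n) {a b : Deg n} (h : a ≤ b) {x : M.carrier}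
    (hx : x ∈ M.deg a) : mono K (b - a) • x ∈ M.deg b := by
  have := M.smul_mem (mono_mem K (sub_nonneg.2 h)) hx
  rwa [sub_add_cancel] at this

/-- `S` as a graded module over itself. -/
noncomputable abbrev free (K : Type u) [Field K] (n : ℕ) : GrMod K n where
  carrier := Pol K n
  deg := polDeg K n
  isInternal := by
    let _ := MvPolynomial.weightedGradedAlgebra K (varDeg n)
    exact DirectSum.Decomposition.isInternal _
  smul_mem := fun hp hx => MvPolynomial.IsWeightedHomogeneous.mul hp hx

/-- The module `M(c)`: the same `S`-module, with `M(c)_b = M_{c + b}`. -/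
abbrev twist (M : GrMod K n) (c : Deg n) : GrMod K n where
  carrier := M.carrier
  deg b := M.deg (c + b)
  isInternal := by
    rw [DirectSum.isInternal_submodule_iff_iSupIndep_and_iSup_eq_top]
    obtain ⟨h1, h2⟩ :=
      (DirectSum.isInternal_submodule_iff_iSupIndep_and_iSup_eq_top _).1 M.isInternal
    refine ⟨h1.comp (add_right_injective c), ?_⟩
    rw [← h2]
    exact (Equiv.addLeft c).iSup_comp (g := M.deg)
  smul_mem := by
    intro a b p x hp hx
    have := M.smul_mem hp hx
    rwa [show a + (c + b) = c + (a + b) by abel] at this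

/-- The degree shift `σ_c`, `σ_c M = M(-c)`. -/
noncomputable def sigma (c : Deg n) : GrMod K n ⥤ GrMod K n where
  obj M := M.twist (-c)
  map {M N} f := (⟨Hom.lin (M := M) (N := N) f, fun h => Hom.map_mem (M := M) (N := N) f h⟩ :
    Hom (M.twist (-c)) (N.twist (-c)))

end GrMod

/-- Auxiliary data for constructing a graded module out of its components: `K`-vector spaces
`G_a` for `a ∈ ℤⁿ`, with maps `G_a → G_b` for `a ≤ b` that are to be the multiplication by the
monomial `x^{b - a}`. -/
structure Family (K : Type u) [Field K] (n : ℕ) : Type (u + 1) where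
  obj : Deg n → Type u
  [addCommGroup : ∀ a, AddCommGroup (obj a)]
  [module : ∀ a, Module K (obj a)]
  map : ∀ {a b : Deg n}, a ≤ b → (obj a →ₗ[K] obj b)
  map_id : ∀ (a : Deg n) (h : a ≤ a) (x : obj a), map h x = x
  map_comp : ∀ {a b c : Deg n} (h : a ≤ b) (h' : b ≤ c) (h'' : a ≤ c) (x : obj a),
    map h' (map h x) = map h'' x

attribute [instance] Family.addCommGroup Family.module

namespace Family
variable {K : Type u} [Field K] {n : ℕ}

/-- The underlying vector space `⨁ G_a`. -/
def Total (F : Family K n) : Type u := DirectSum (Deg n) F.obj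

noncomputable instance (F : Family K n) : AddCommGroup F.Total :=
  inferInstanceAs (AddCommGroup (DirectSum (Deg n) F.obj))

noncomputable instance (F : Family K n) : Module K F.Total :=
  inferInstanceAs (Module K (DirectSum (Deg n) F.obj))

/-- The inclusion of a component. -/
noncomputable def incl (F : Family K n) (a : Deg n) : F.obj a →ₗ[K] F.Total :=
  DirectSum.lof K (Deg n) F.obj a

/-- A linear map on `⨁ G_a` from its restrictions to the components. -/
noncomputable def desc (F : Family K n) {V : Type*} [AddCommGroup V] [Module K V]
    (f : ∀ a, F.obj a →ₗ[K] V) : F.Total →ₗ[K] V :=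
  DirectSum.toModule K (Deg n) V f

theorem desc_incl (F : Family K n) {V : Type*} [AddCommGroup V] [Module K V]
    (f : ∀ a, F.obj a →ₗ[K] V) (a : Deg n) (x : F.obj a) : F.desc f (F.incl a x) = f a x :=
  DirectSum.toModule_lof K a x

theorem total_ext (F : Family K n) {V : Type*} [AddCommGroup V] [Module K V]
    {f g : F.Total →ₗ[K] V} (h : ∀ a x, f (F.incl a x) = g (F.incl a x)) : f = g :=
  DirectSum.linearMap_ext K fun a => LinearMap.ext (h a)

/-- The projection to a component. -/
noncomputable def proj (F : Family K n) (b : Deg n) : F.Total →ₗ[K] F.obj b :=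
  DirectSum.component K (Deg n) F.obj b

theorem proj_incl_same (F : Family K n) (a : Deg n) (x : F.obj a) :
    F.proj a (F.incl a x) = x :=
  DirectSum.component.lof_self K a x

theorem proj_incl_of_ne (F : Family K n) {a b : Deg n} (h : a ≠ b) (x : F.obj a) :
    F.proj b (F.incl a x) = 0 :=
  DirectSum.of_eq_of_ne (β := F.obj) a b x h.symm

theorem total_induction (F : Family K n) {P : F.Total → Prop} (zero : P 0)
    (incl : ∀ a x, P (F.incl a x)) (add : ∀ x y, P x → P y → P (x + y)) (x : F.Total) : P x :=
  DirectSum.induction_on (motive := P) x zero incl add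

/-- The exponent of a monomial as an element of `ℤⁿ`. -/
def expo (m : Fin n →₀ ℕ) : Deg n := fun i => (m i : ℤ)

theorem le_expo_add (m : Fin n →₀ ℕ) (a : Deg n) : a ≤ expo m + a := by
  intro i; simp [expo]

theorem incl_map_congr (F : Family K n) {a b b' : Deg n} (h : a ≤ b) (h' : a ≤ b') (e : b = b')
    (x : F.obj a) : F.incl b (F.map h x) = F.incl b' (F.map h' x) := by
  subst e; rfl

/-- Multiplication by the monomial with exponent `m`. -/
noncomputable def act (F : Family K n) : Multiplicative (Fin n →₀ ℕ) →* Module.End K F.Total where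
  toFun m := F.desc fun a => F.incl (expo m.toAdd + a) ∘ₗ F.map (le_expo_add m.toAdd a)
  map_one' := by
    apply total_ext
    intro a x
    rw [desc_incl, LinearMap.comp_apply, Module.End.one_apply,
      F.incl_map_congr _ le_rfl (by ext i; simp [expo]), F.map_id]
  map_mul' m m' := by
    apply total_ext
    intro a x
    simp only [Module.End.mul_apply, desc_incl, LinearMap.comp_apply]
    rw [F.map_comp _ _ ((le_expo_add _ a).trans (le_expo_add _ _))]
    exact F.incl_map_congr _ _ (by ext i; simp [expo, add_assoc]) x

/-- The action of `S` on `⨁ G_a`. -/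
noncomputable def actAlg (F : Family K n) : Pol K n →ₐ[K] Module.End K F.Total :=
  AddMonoidAlgebra.lift K (Module.End K F.Total) (Fin n →₀ ℕ) F.act

noncomputable instance (F : Family K n) : Module (Pol K n) F.Total :=
  Module.compHom F.Total F.actAlg.toRingHom

theorem smul_def (F : Family K n) (p : Pol K n) (x : F.Total) : p • x = F.actAlg p x := rfl

instance (F : Family K n) : IsScalarTower K (Pol K n) F.Total where
  smul_assoc c p x := by rw [smul_def, smul_def, map_smul, LinearMap.smul_apply]

theorem monomial_smul_incl (F : Family K n) (m : Fin n →₀ ℕ) (c : K) (a : Deg n) (x : F.obj a) :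
    (MvPolynomial.monomial m c : Pol K n) • F.incl a x =
      F.incl (expo m + a) (c • F.map (le_expo_add m a) x) := by
  rw [smul_def]
  have : F.actAlg (MvPolynomial.monomial m c) = c • F.act (Multiplicative.ofAdd m) :=
    AddMonoidAlgebra.lift_single _ _ _
  rw [this, LinearMap.smul_apply]
  change c • (F.desc _ (F.incl a x)) = _
  rw [desc_incl, LinearMap.comp_apply, map_smul]
  rfl

theorem monomial_smul_mem (F : Family K n) (m : Fin n →₀ ℕ) (c : K) {a : Deg n} {x : F.Total}
    (hx : x ∈ LinearMap.range (F.incl a)) :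
    (MvPolynomial.monomial m c : Pol K n) • x ∈ LinearMap.range (F.incl (expo m + a)) := by
  obtain ⟨y, rfl⟩ := hx
  exact ⟨_, (F.monomial_smul_incl m c a y).symm⟩

theorem isInternal_range (F : Family K n) :
    DirectSum.IsInternal fun a => LinearMap.range (F.incl a) := by
  have key : ∀ (w : DirectSum (Deg n) fun a => LinearMap.range (F.incl a)) (b : Deg n),
      F.proj b (DirectSum.coeAddMonoidHom (fun a => LinearMap.range (F.incl a)) w) =
        F.proj b (w b : F.Total) := by
    intro w b
    induction w using DirectSum.induction_on with
    | zero => rw [map_zero]; rfl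
    | of a y =>
      rw [DirectSum.coeAddMonoidHom_of]
      by_cases h : a = b
      · subst h; rw [DirectSum.of_eq_same]
      · rw [DirectSum.of_eq_of_ne _ _ _ (Ne.symm h)]
        obtain ⟨_, y, rfl⟩ := y
        exact (F.proj_incl_of_ne h y).trans (map_zero _).symm
    | add v w hv hw =>
      rw [map_add, map_add, hv, hw, DirectSum.add_apply, Submodule.coe_add, map_add]
  constructor
  · rw [← AddMonoidHom.ker_eq_bot_iff, eq_bot_iff]
    intro z hz
    rw [AddMonoidHom.mem_ker] at hz
    rw [AddSubgroup.mem_bot]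
    ext b
    obtain ⟨y, hy⟩ := (z b).2
    have h := key z b
    rw [hz, map_zero, ← hy, proj_incl_same] at h
    rw [← hy, ← h, map_zero]; rfl
  · intro x
    induction x using F.total_induction with
    | zero => exact ⟨0, map_zero _⟩
    | incl a y =>
      exact ⟨DirectSum.of (fun a => LinearMap.range (F.incl a)) a ⟨F.incl a y, y, rfl⟩,
        DirectSum.coeAddMonoidHom_of _ _ _⟩
    | add x y hx hy =>
      obtain ⟨v, rfl⟩ := hx
      obtain ⟨w, rfl⟩ := hy
      exact ⟨v + w, map_add _ _ _⟩

/-- The graded module `⨁ G_a`. -/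
noncomputable abbrev toGrMod (F : Family K n) : GrMod K n where
  carrier := F.Total
  deg a := LinearMap.range (F.incl a)
  isInternal := F.isInternal_range
  smul_mem := by
    intro a b p x hp hx
    rw [p.as_sum, Finset.sum_smul]
    refine Submodule.sum_mem _ fun m hm => ?_
    have h := hp (MvPolynomial.mem_support_iff.1 hm)
    rw [weight_varDeg] at h
    rw [← h]
    exact F.monomial_smul_mem m _ hx

/-- Compatible linear maps of components give an `S`-linear map. -/
noncomputable def linMk {F G : Family K n} (f : ∀ a, F.obj a →ₗ[K] G.obj a)
    (hf : ∀ {a b : Deg n} (h : a ≤ b) (x : F.obj a), f b (F.map h x) = G.map h (f a x)) :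
    F.Total →ₗ[Pol K n] G.Total where
  toFun := F.desc fun a => G.incl a ∘ₗ f a
  map_add' := map_add _
  map_smul' := by
    intro p x
    rw [RingHom.id_apply]
    induction x using F.total_induction with
    | zero => rw [smul_zero, map_zero, smul_zero]
    | incl a y =>
      induction p using MvPolynomial.induction_on' with
      | monomial m c =>
        rw [monomial_smul_incl, desc_incl, desc_incl, LinearMap.comp_apply,
          LinearMap.comp_apply, monomial_smul_incl, map_smul, hf]
      | add p q hp hq => rw [add_smul, map_add, hp, hq, add_smul]
    | add x y hx hy => rw [smul_add, map_add, hx, hy, map_add, smul_add]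

/-- Compatible linear maps of components give a morphism of graded modules. -/
noncomputable def homMk {F G : Family K n} (f : ∀ a, F.obj a →ₗ[K] G.obj a)
    (hf : ∀ {a b : Deg n} (h : a ≤ b) (x : F.obj a), f b (F.map h x) = G.map h (f a x)) :
    F.toGrMod ⟶ G.toGrMod where
  lin := linMk f hf
  map_mem := by
    rintro a _ ⟨y, rfl⟩
    exact ⟨f a y, (F.desc_incl (fun a => G.incl a ∘ₗ f a) a y).symm⟩

theorem homMk_incl {F G : Family K n} (f : ∀ a, F.obj a →ₗ[K] G.obj a)
    (hf : ∀ {a b : Deg n} (h : a ≤ b) (x : F.obj a), f b (F.map h x) = G.map h (f a x))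
    (a : Deg n) (x : F.obj a) :
    (homMk f hf).lin (F.incl a x) = G.incl a (f a x) :=
  F.desc_incl _ a x

theorem hom_ext {F : Family K n} {M : GrMod K n} {f g : F.toGrMod ⟶ M}
    (h : ∀ a x, GrMod.Hom.lin f (F.incl a x) = GrMod.Hom.lin g (F.incl a x)) : f = g := by
  apply GrMod.hom_ext
  apply LinearMap.ext
  exact F.total_induction ((map_zero _).trans (map_zero _).symm) h fun x y hx hy =>
    (map_add _ _ _).trans ((congrArg₂ _ hx hy).trans (map_add _ _ _).symm)

/-- Morphisms of families: linear maps of components that commute with the multiplications. -/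
@[ext]
structure Hom (F G : Family K n) : Type u where
  app : ∀ a, F.obj a →ₗ[K] G.obj a
  comm : ∀ {a b : Deg n} (h : a ≤ b) (x : F.obj a), app b (F.map h x) = G.map h (app a x)

noncomputable instance : Category (Family K n) where
  Hom F G := Hom F G
  id F := ⟨fun _ => LinearMap.id, fun _ _ => rfl⟩
  comp f g := ⟨fun a => g.app a ∘ₗ f.app a, fun h x =>
    (congrArg (g.app _) (f.comm h x)).trans (g.comm h _)⟩

/-- The functor `G ↦ ⨁ G_a` from families to graded modules. -/
noncomputable def total (K : Type u) [Field K] (n : ℕ) : Family K n ⥤ GrMod K n where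
  obj F := F.toGrMod
  map {F G} f := homMk (Hom.app (F := F) (G := G) f) (Hom.comm (F := F) (G := G) f)
  map_id F := hom_ext fun a x =>
    homMk_incl (F := F) (G := F) (fun _ => LinearMap.id) (fun _ _ => rfl) a x
  map_comp {F G H} f g := by
    refine hom_ext fun a x => ?_
    refine (homMk_incl (f ≫ g).app (f ≫ g).comm a x).trans (Eq.symm ?_)
    exact (congrArg (homMk g.app g.comm).lin (homMk_incl f.app f.comm a x)).trans
      (homMk_incl g.app g.comm a (f.app a x))

end Family

namespace GrMod
variable {K : Type u} [Field K] {n : ℕ}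

section reindex

/-- The subspace `M_{q(b)}` if `b ≥ c`, and `0` otherwise. -/
def reindexDeg (M : GrMod K n) (c : Deg n) (q : Deg n → Deg n) (b : Deg n) :
    Submodule K M.carrier where
  carrier := {x | (c ≤ b → x ∈ M.deg (q b)) ∧ (¬ c ≤ b → x = 0)}
  add_mem' := fun hx hy =>
    ⟨fun h => add_mem (hx.1 h) (hy.1 h), fun h => by rw [hx.2 h, hy.2 h, add_zero]⟩
  zero_mem' := ⟨fun _ => zero_mem _, fun _ => rfl⟩
  smul_mem' := fun k _ hx =>
    ⟨fun h => Submodule.smul_mem _ k (hx.1 h), fun h => by rw [hx.2 h, smul_zero]⟩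

/-- Multiplication by the monomial `x^{q(b') - q(b)}` as a map from the `b`-th to the `b'`-th
component. -/
noncomputable def reindexMap (M : GrMod K n) (c : Deg n) (q : Deg n → Deg n)
    (hq : MonotoneOn q (Set.Ici c)) {b b' : Deg n} (h : b ≤ b') :
    M.reindexDeg c q b →ₗ[K] M.reindexDeg c q b' where
  toFun x := ⟨mono K (q b' - q b) • x.1, by
    by_cases hb : c ≤ b
    · exact ⟨fun hb' => M.mono_smul_mem (hq hb hb' h) (x.2.1 hb), fun hb' => (hb' (hb.trans h)).elim⟩
    · rw [x.2.2 hb, smul_zero]; exact zero_mem _⟩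
  map_add' x y := Subtype.ext (smul_add _ _ _)
  map_smul' k x := Subtype.ext (smul_comm _ _ _)

/-- The components `M_{q(b)}` for `b ≥ c`, where `q` is order preserving in this range, and the
maps `f_{q(b)}` of a morphism `f`. -/
noncomputable def reindexFamily (c : Deg n) (q : Deg n → Deg n)
    (hq : MonotoneOn q (Set.Ici c)) : GrMod K n ⥤ Family K n where
  obj M :=
    { obj := fun b => M.reindexDeg c q b
      map := fun h => M.reindexMap c q hq h
      map_id := fun a h x => Subtype.ext <| by
        change mono K (q a - q a) • x.1 = x.1
        rw [sub_self, mono_zero, one_smul]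
      map_comp := fun {a b d} h h' h'' x => Subtype.ext <| by
        change mono K (q d - q b) • mono K (q b - q a) • x.1 = mono K (q d - q a) • x.1
        by_cases ha : c ≤ a
        · have hb := ha.trans h
          have hd := hb.trans h'
          rw [smul_smul, ← mono_add K (sub_nonneg.2 (hq hb hd h')) (sub_nonneg.2 (hq ha hb h)),
            sub_add_sub_cancel]
        · rw [x.2.2 ha]; simp only [smul_zero] }
  map {M N} f :=
    { app := fun _ => ((Hom.lin f).restrictScalars K).restrict fun _ hx =>
        ⟨fun h => Hom.map_mem f (hx.1 h), fun h => by rw [hx.2 h, map_zero]⟩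
      comm := fun _ _ => Subtype.ext (map_smul (Hom.lin f) _ _) }
  map_id _ := rfl
  map_comp _ _ := rfl

/-- The functor with `M ↦ ⨁_{b ≥ c} M_{q(b)}` on objects, in which `x^{b' - b}` acts from degree
`b` to degree `b'` as multiplication by `x^{q(b') - q(b)}` in `M`, and with `f ↦ ⨁_b f_{q(b)}` on
morphisms. -/
noncomputable def reindex (c : Deg n) (q : Deg n → Deg n) (hq : MonotoneOn q (Set.Ici c)) :
    GrMod K n ⥤ GrMod K n :=
  reindexFamily c q hq ⋙ Family.total K n

end reindex

/-- The truncation `τ_c M = ⨁_{b ≥ c} M_b`. -/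
noncomputable def tau (c : Deg n) : GrMod K n ⥤ GrMod K n :=
  reindex c id monotoneOn_id

/-- The functor `q^*` of an order preserving map `q : ℕⁿ → ℤⁿ`: `(q^* M)_b = M_{q(b)}` for
`b ∈ ℕⁿ`, and `(q^* M)_b = 0` for `b ∈ ℤⁿ ∖ ℕⁿ`. -/
noncomputable def pull (q : (Fin n → ℕ) →o Deg n) : GrMod K n ⥤ GrMod K n :=
  reindex 0 (fun b => q fun i => (b i).toNat)
    (fun _ _ _ _ h => q.monotone fun i => Int.toNat_le_toNat (h i))

/-- The map `r : ℕⁿ → ℕⁿ ⊆ ℤⁿ`, `r(a)_i = t_i` if `a_i > 0` and `0` otherwise. -/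
def rMap (t : Fin n → ℕ) : (Fin n → ℕ) →o Deg n where
  toFun a i := if 0 < a i then (t i : ℤ) else 0
  monotone' a b h i := by
    have hi : a i ≤ b i := h i
    change (if 0 < a i then (t i : ℤ) else 0) ≤ (if 0 < b i then (t i : ℤ) else 0)
    split_ifs <;> omega

/-- The map `s : ℕⁿ → ℤⁿ`, `s(a)_i = t_i` if `a_i ≥ 1` and `t_i - 1` otherwise. -/
def sMap (t : Fin n → ℕ) : (Fin n → ℕ) →o Deg n where
  toFun a i := if 1 ≤ a i then (t i : ℤ) else (t i : ℤ) - 1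
  monotone' a b h i := by
    have hi : a i ≤ b i := h i
    change (if 1 ≤ a i then (t i : ℤ) else (t i : ℤ) - 1) ≤ (if 1 ≤ b i then (t i : ℤ) else (t i : ℤ) - 1)
    split_ifs <;> omega

/-- The functor `r^*`. -/
noncomputable abbrev rStar (t : Fin n → ℕ) : GrMod K n ⥤ GrMod K n := pull (rMap t)

/-- The functor `s^*`. -/
noncomputable abbrev sStar (t : Fin n → ℕ) : GrMod K n ⥤ GrMod K n := pull (sMap t)

section grHom

/-- The `K`-space of morphisms `M ⟶ N(a)`: the `S`-linear maps with `f(M_b) ⊆ N_{a + b}`. -/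
def homDeg (M N : GrMod K n) (a : Deg n) : Submodule K (M.carrier →ₗ[Pol K n] N.carrier) where
  carrier := {f | ∀ (b : Deg n) (x : M.carrier), x ∈ M.deg b → f x ∈ (N.twist a).deg b}
  add_mem' := fun hf hg b x hx => Submodule.add_mem _ (hf b x hx) (hg b x hx)
  zero_mem' := fun _ _ _ => Submodule.zero_mem _
  smul_mem' := fun k _ hf b x hx => Submodule.smul_mem _ k (hf b x hx)

/-- The components of `⨁_a Hom(M, N(a))`; a monomial acts by `f ↦ x^{a' - a} f`. -/
noncomputable def homFamily (N : GrMod K n) : (GrMod K n)ᵒᵖ ⥤ Family K n where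
  obj M :=
    { obj := fun a => M.unop.homDeg N a
      map := fun {a a'} h =>
        { toFun := fun f => ⟨mono K (a' - a) • f.1, fun b x hx => by
            have := N.mono_smul_mem (add_le_add_left h b) (f.2 _ x hx)
            rwa [add_sub_add_right_eq_sub] at this⟩
          map_add' := fun _ _ => Subtype.ext (smul_add _ _ _)
          map_smul' := fun _ _ => Subtype.ext (smul_comm _ _ _) }
      map_id := fun a h f => Subtype.ext <| by
        change mono K (a - a) • f.1 = f.1
        rw [sub_self, mono_zero, one_smul]
      map_comp := fun {a b d} h h' h'' f => Subtype.ext <| by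
        change mono K (d - b) • mono K (b - a) • f.1 = mono K (d - a) • f.1
        rw [smul_smul, ← mono_add K (sub_nonneg.2 h') (sub_nonneg.2 h), sub_add_sub_cancel] }
  map φ :=
    { app := fun _ =>
        { toFun := fun f => ⟨f.1 ∘ₗ Hom.lin φ.unop, fun _ _ hx =>
            f.2 _ _ (Hom.map_mem φ.unop hx)⟩
          map_add' := fun _ _ => rfl
          map_smul' := fun _ _ => rfl }
      comm := fun _ _ => rfl }
  map_id _ := rfl
  map_comp _ _ := rfl

/-- The graded module `grHom_S(M, N) = ⨁_a Hom(M, N(a))`, contravariant in `M`. -/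
noncomputable def grHom (N : GrMod K n) : (GrMod K n)ᵒᵖ ⥤ GrMod K n :=
  homFamily N ⋙ Family.total K n

end grHom

/-- The contravariant functor `D_t = σ_t ∘ grHom_S(-, S)`. -/
noncomputable def dual (K : Type u) [Field K] {n : ℕ} (t : Fin n → ℕ) :
    (GrMod K n)ᵒᵖ ⥤ GrMod K n :=
  grHom (free K n) ⋙ sigma fun i => (t i : ℤ)

/-- Positively `t`-determined modules: finitely generated, `ℕⁿ`-graded, and such that
multiplication by `x_i` is a bijection `M_a → M_{a + e_i}` whenever `a_i ≥ t_i`. -/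
def PosDet (K : Type u) [Field K] {n : ℕ} (t : Fin n → ℕ) : ObjectProperty (GrMod K n) :=
  fun M => Module.Finite (Pol K n) M.carrier ∧
    (∀ a : Deg n, ¬ 0 ≤ a → M.deg a = ⊥) ∧
    ∀ (a : Deg n) (i : Fin n), (t i : ℤ) ≤ a i →
      Set.BijOn (fun x : M.carrier => (MvPolynomial.X i : Pol K n) • x)
        (M.deg a) (M.deg (a + varDeg n i))

/-- The full subcategory `Mod_t`. -/
abbrev ModT (K : Type u) [Field K] {n : ℕ} (t : Fin n → ℕ) : Type (u + 1) :=
  (PosDet K t).FullSubcategory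

/-- The inclusion of `Mod_t`. -/
noncomputable abbrev inclT (K : Type u) [Field K] {n : ℕ} (t : Fin n → ℕ) : ModT K t ⥤ GrMod K n :=
  (PosDet K t).ι

end GrMod

end MultiGr

/-!
Let `ε : S → K` send all variables to `1`. Since `ε` is injective on each component of `S`, a degree
preserving map `f : M → S(a)` is the same as the functional `φ = ε ∘ f` on `M`, which satisfies
`φ(x^d m) = φ(m)` (it is "equivariant") and vanishes on `M_b` unless `b ≥ -a` (`mem_range_augComp`).
Multiplication of `f` by a monomial does not change `φ`. So `D_c M` is the family of subspaces
`{φ equivariant, φ(M_b) = 0 unless b ≥ c - a}`, `a ∈ ℤⁿ`, of the dual space of `M`, with inclusions as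
multiplication maps (`dualEval_isRealization`, `mem_map_dualEval`).

If `M` is `t`-determined, restriction identifies the equivariant functionals on `M` with all
functionals on `M_t` (`Determined.eq_zero_of_equivariant`, `Determined.exists_equivariant`). For `q = r`
or `q = s` the module `q^* M` is `1`-determined with `(q^* M)_1 = M_t`, so the equivariant functionals on
`M` and on `q^* M` agree. Both sides of each isomorphism have thus become families of subspaces of the
dual space of `q^* M`, and it remains to compare the vanishing conditions (`map_pullEval`). In degree
`a ≥ 0`, both `τ_0 ∘ D_1` and `D_1 ∘ r^*` require vanishing on the `M_b` with `b_i = 0`, for all `i` with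
`a_i = 0`, and both `r^* ∘ D_t` and `D_1 ∘ s^*` require vanishing on the `M_b` with `b_i ≤ t_i - 1`, for
all `i` with `a_i = 0`. In the other degrees all of them are `0`. The isomorphisms are natural because the realizations are
(`pullEval_map`, `dualEval_map`).

Finally, `D_1` preserves positively `1`-determined modules (`dual_posDet`), where finite generation
is handled through its equivalent, for determined modules, that all components are
finite-dimensional (`posDet_iff`).
-/

namespace MultiGr

/-! ### The augmentation of the polynomial ring -/

section augmentation
variable (K : Type u) [Field K] {n : ℕ}

/-- The augmentation `S → K` that sends every variable to `1`. It is injective on each graded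
component of `S`. -/
noncomputable def aug : Pol K n →ₐ[K] K := MvPolynomial.aeval fun _ => 1

variable {K}

theorem aug_monomial (m : Fin n →₀ ℕ) (c : K) : aug K (MvPolynomial.monomial m c) = c := by
  simp [aug, MvPolynomial.aeval_monomial]

theorem aug_mono (d : Deg n) : aug K (mono K d) = 1 := aug_monomial _ _

theorem aug_X (i : Fin n) : aug K (MvPolynomial.X i : Pol K n) = 1 := by simp [aug]

theorem mono_expo (m : Fin n →₀ ℕ) : mono K (Family.expo m) = MvPolynomial.monomial m 1 := by
  rw [mono]
  congr 2
  ext i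
  simp [Family.expo]

theorem expo_nonneg (m : Fin n →₀ ℕ) : 0 ≤ Family.expo m := fun i => by simp [Family.expo]

theorem exists_expo {d : Deg n} (hd : 0 ≤ d) : ∃ m : Fin n →₀ ℕ, Family.expo m = d :=
  ⟨Finsupp.equivFunOnFinite.symm fun i => (d i).toNat, funext fun i => by
    simpa [Family.expo] using hd i⟩

theorem monomial_mem (m : Fin n →₀ ℕ) (c : K) :
    MvPolynomial.monomial m c ∈ polDeg K n (Family.expo m) :=
  MvPolynomial.isWeightedHomogeneous_monomial _ _ _ (weight_varDeg m)

theorem mono_varDeg (i : Fin n) : mono K (varDeg n i) = MvPolynomial.X i := by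
  rw [mono, MvPolynomial.X]
  congr 2
  ext j
  by_cases h : i = j
  · subst h; simp [varDeg]
  · simp [varDeg, Ne.symm h]

/-- A component `S_d` is spanned by the monomial of degree `d`, and the coefficient is the value
of the augmentation. -/
theorem eq_aug_smul_mono {d : Deg n} {p : Pol K n} (hp : p ∈ polDeg K n d) :
    p = aug K p • mono K d := by
  have key : ∀ m ∈ p.support, m = Finsupp.equivFunOnFinite.symm fun i => (d i).toNat := by
    intro m hm
    have h := hp (MvPolynomial.mem_support_iff.1 hm)
    rw [weight_varDeg] at h
    ext i
    simp [← h]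
  obtain ⟨c, h2⟩ : ∃ c, p = MvPolynomial.monomial
      (Finsupp.equivFunOnFinite.symm fun i => (d i).toNat) c := by
    refine ⟨MvPolynomial.coeff (Finsupp.equivFunOnFinite.symm fun i => (d i).toNat) p, ?_⟩
    ext m
    rw [MvPolynomial.coeff_monomial]
    split_ifs with h
    · rw [h]
    · by_contra hm
      exact h (key m (MvPolynomial.mem_support_iff.2 hm)).symm
  rw [h2, aug_monomial, mono, MvPolynomial.smul_monomial, smul_eq_mul, mul_one]

theorem eq_zero_of_not_nonneg {d : Deg n} (hd : ¬ 0 ≤ d) {p : Pol K n}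
    (hp : p ∈ polDeg K n d) : p = 0 := by
  ext m
  by_contra hm
  have h := hp hm
  rw [weight_varDeg] at h
  exact hd (h ▸ fun i => by simp)

end augmentation

namespace GrMod
variable {K : Type u} [Field K] {n : ℕ}

/-! ### Components of a graded module -/

section graded
variable (M : GrMod K n)

theorem iSup_deg : ⨆ a, M.deg a = ⊤ :=
  ((DirectSum.isInternal_submodule_iff_iSupIndep_and_iSup_eq_top _).1 M.isInternal).2

variable {M}

theorem induction_deg {P : M.carrier → Prop} (zero : P 0) (deg : ∀ a, ∀ x ∈ M.deg a, P x)
    (add : ∀ x y, P x → P y → P (x + y)) (x : M.carrier) : P x :=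
  Submodule.iSup_induction M.deg (motive := P) (M.iSup_deg ▸ Submodule.mem_top : x ∈ _)
    deg zero add

theorem linearMap_ext_deg {V : Type*} [AddCommGroup V] [Module K V]
    {φ ψ : M.carrier →ₗ[K] V} (h : ∀ a, ∀ x ∈ M.deg a, φ x = ψ x) : φ = ψ :=
  LinearMap.ext <| induction_deg ((map_zero _).trans (map_zero _).symm) h fun x y hx hy => by
    rw [map_add, map_add, hx, hy]

/-- Linear maps out of the components of a graded module glue to a linear map out of the
module. -/
theorem exists_linearMap {V : Type*} [AddCommGroup V] [Module K V]
    (g : ∀ a, M.deg a →ₗ[K] V) :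
    ∃ φ : M.carrier →ₗ[K] V, ∀ a (x : M.deg a), φ x = g a x := by
  classical
  let _ := M.isInternal.chooseDecomposition
  refine ⟨DirectSum.toModule K _ V g ∘ₗ (DirectSum.decomposeLinearEquiv M.deg).toLinearMap,
    fun a x => ?_⟩
  rw [LinearMap.comp_apply, LinearEquiv.coe_coe, DirectSum.decomposeLinearEquiv_apply,
    DirectSum.decompose_coe]
  exact DirectSum.toModule_lof (M := fun a => M.deg a) (φ := g) K a x

end graded

/-! ### Equivariant maps and realizations -/

section equivariant
variable {V W : Type*} [AddCommGroup V] [Module K V] [AddCommGroup W] [Module K W]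

/-- A `K`-linear map `φ : M → V` is equivariant if it is `S`-linear for the action of `S` on `V`
through the augmentation. Equivalently, `φ` takes the same value on `m` and on `x^d m`: it is a
linear map out of the colimit of the components of `M`. -/
def Equivariant {M : GrMod K n} (φ : M.carrier →ₗ[K] V) : Prop :=
  ∀ (p : Pol K n) (x : M.carrier), φ (p • x) = aug K p • φ x

theorem Equivariant.mono_smul {M : GrMod K n} {φ : M.carrier →ₗ[K] V} (h : Equivariant φ)
    (d : Deg n) (x : M.carrier) : φ (mono K d • x) = φ x := by
  rw [h, aug_mono, one_smul]

theorem Equivariant.of_mono {M : GrMod K n} {φ : M.carrier →ₗ[K] V}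
    (h : ∀ d : Deg n, 0 ≤ d → ∀ a, ∀ x ∈ M.deg a, φ (mono K d • x) = φ x) : Equivariant φ := by
  intro p x
  induction x using induction_deg with
  | zero => simp
  | add x y hx hy => rw [smul_add, map_add, map_add, hx, hy, smul_add]
  | deg a x hx =>
    induction p using MvPolynomial.induction_on' with
    | monomial m c =>
      have : MvPolynomial.monomial m c = c • mono K (Family.expo m) := by
        rw [mono_expo, MvPolynomial.smul_monomial, smul_eq_mul, mul_one]
      rw [aug_monomial, this, smul_assoc, map_smul, h _ (expo_nonneg m) a x hx]
    | add p q hp hq => rw [add_smul, map_add, hp, hq, map_add, add_smul]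

theorem Equivariant.comp {M : GrMod K n} {φ : M.carrier →ₗ[K] V} (h : Equivariant φ)
    (g : V →ₗ[K] W) : Equivariant (g ∘ₗ φ) := fun p x => by
  rw [LinearMap.comp_apply, h, map_smul, LinearMap.comp_apply]

/-- A realization of `M` in `V` is an equivariant map that is injective on every component: it
turns `M` into a family of subspaces of `V`, indexed by `ℤⁿ`, on which the monomials act as
inclusions. -/
structure IsRealization {M : GrMod K n} (φ : M.carrier →ₗ[K] V) : Prop where
  equivariant : Equivariant φ
  injOn : ∀ a, ∀ x ∈ M.deg a, φ x = 0 → x = 0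

theorem IsRealization.eq_of_apply_eq {M : GrMod K n} {φ : M.carrier →ₗ[K] V}
    (h : IsRealization φ) {a : Deg n} {x y : M.carrier} (hx : x ∈ M.deg a) (hy : y ∈ M.deg a)
    (e : φ x = φ y) : x = y :=
  sub_eq_zero.1 (h.injOn a _ (sub_mem hx hy) (by rw [map_sub, e, sub_self]))

/-- The morphism of `IsRealization.exists_lift` is unique. -/
theorem IsRealization.hom_ext {M N : GrMod K n} {σ : N.carrier →ₗ[K] V}
    (hσ : IsRealization σ) {f g : M ⟶ N} (h : ∀ x, σ (Hom.lin f x) = σ (Hom.lin g x)) : f = g := by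
  refine GrMod.hom_ext (LinearMap.ext fun x => ?_)
  induction x using induction_deg with
  | zero => rw [map_zero, map_zero]
  | deg a x hx => exact hσ.eq_of_apply_eq (Hom.map_mem f hx) (Hom.map_mem g hx) (h x)
  | add x y hx hy => rw [map_add, map_add, hx, hy]

/-- An equivariant map `M → V` factors through a realization of `N` in `V` by a morphism
`M ⟶ N` as soon as it does so on each component. -/
theorem IsRealization.exists_lift {M N : GrMod K n} {ρ : M.carrier →ₗ[K] V}
    {σ : N.carrier →ₗ[K] V} (hσ : IsRealization σ) (hρ : Equivariant ρ)
    (h : ∀ a, (M.deg a).map ρ ≤ (N.deg a).map σ) :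
    ∃ f : M ⟶ N, ∀ x, σ (Hom.lin f x) = ρ x := by
  have inj (a : Deg n) : Function.Injective (σ.submoduleMap (N.deg a)) := fun x y e =>
    Subtype.ext (hσ.eq_of_apply_eq x.2 y.2 (congrArg Subtype.val e))
  let e (a : Deg n) : N.deg a ≃ₗ[K] (N.deg a).map σ :=
    LinearEquiv.ofBijective _ ⟨inj a, σ.submoduleMap_surjective _⟩
  let g (a : Deg n) : M.deg a →ₗ[K] N.carrier :=
    (N.deg a).subtype ∘ₗ (e a).symm.toLinearMap ∘ₗ ρ.restrict fun x hx => h a ⟨x, hx, rfl⟩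
  have hg (a : Deg n) (x : M.deg a) : σ (g a x) = ρ x :=
    congrArg Subtype.val ((e a).apply_symm_apply (ρ.restrict (fun x hx => h a ⟨x, hx, rfl⟩) x))
  obtain ⟨f, hf⟩ := exists_linearMap g
  have mem {a : Deg n} {x : M.carrier} (hx : x ∈ M.deg a) : f x ∈ N.deg a := by
    rw [show f x = _ from hf a ⟨x, hx⟩]
    exact Subtype.property _
  have hσf {a : Deg n} {x : M.carrier} (hx : x ∈ M.deg a) : σ (f x) = ρ x := by
    rw [show f x = _ from hf a ⟨x, hx⟩, hg]
  have smul (p : Pol K n) (x : M.carrier) : f (p • x) = p • f x := by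
    induction x using induction_deg with
    | zero => rw [smul_zero, map_zero, smul_zero]
    | add x y hx hy => rw [smul_add, map_add, map_add, hx, hy, smul_add]
    | deg a x hx =>
      induction p using MvPolynomial.induction_on' with
      | monomial m c =>
        have hx' := M.smul_mem (monomial_mem m c) hx
        refine hσ.eq_of_apply_eq (mem hx') (N.smul_mem (monomial_mem m c) (mem hx)) ?_
        rw [hσf hx', hρ, hσ.equivariant, hσf hx]
      | add p q hp hq => rw [add_smul, map_add, hp, hq, add_smul]
  refine ⟨(⟨{ f with map_smul' := smul }, mem⟩ : Hom M N), fun x => ?_⟩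
  exact LinearMap.congr_fun (linearMap_ext_deg (φ := σ ∘ₗ f) (ψ := ρ) fun a x hx => hσf hx) x

/-- Two graded modules that are realized in `V` by the same subspaces are isomorphic, compatibly
with the realizations. -/
theorem IsRealization.exists_iso {M N : GrMod K n} {ρ : M.carrier →ₗ[K] V}
    {σ : N.carrier →ₗ[K] V} (hρ : IsRealization ρ) (hσ : IsRealization σ)
    (h : ∀ a, (M.deg a).map ρ = (N.deg a).map σ) :
    ∃ e : M ≅ N, ∀ x, σ (Hom.lin e.hom x) = ρ x := by
  obtain ⟨f, hf⟩ := hσ.exists_lift hρ.equivariant fun a => (h a).le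
  obtain ⟨g, hg⟩ := hρ.exists_lift hσ.equivariant fun a => (h a).ge
  refine ⟨⟨f, g, hρ.hom_ext fun x => ?_, hσ.hom_ext fun x => ?_⟩, hf⟩
  · rw [comp_lin, LinearMap.comp_apply, hg, hf]; rfl
  · rw [comp_lin, LinearMap.comp_apply, hf, hg]; rfl

end equivariant

/-! ### Determined modules -/

section determined

/-- The part of the definition of a positively `t`-determined module that is not the finite
generation. -/
structure Determined (t : Fin n → ℕ) (M : GrMod K n) : Prop where
  eq_bot : ∀ a : Deg n, ¬ 0 ≤ a → M.deg a = ⊥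
  bijOn : ∀ (a : Deg n) (i : Fin n), (t i : ℤ) ≤ a i →
    Set.BijOn (fun x : M.carrier => (MvPolynomial.X i : Pol K n) • x)
      (M.deg a) (M.deg (a + varDeg n i))

variable {t : Fin n → ℕ} {M : GrMod K n}

theorem Determined.bijOn_monomial (h : Determined t M) (m : Fin n →₀ ℕ) :
    ∀ a : Deg n, (∀ i, 0 < m i → (t i : ℤ) ≤ a i) →
      Set.BijOn (fun x : M.carrier => (MvPolynomial.monomial m 1 : Pol K n) • x)
        (M.deg a) (M.deg (a + Family.expo m)) := by
  have expo_add (m m' : Fin n →₀ ℕ) :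
      Family.expo (m + m') = Family.expo m + Family.expo m' := by
    ext i; simp [Family.expo]
  have add (m m' : Fin n →₀ ℕ)
      (hm : ∀ a : Deg n, (∀ i, 0 < m i → (t i : ℤ) ≤ a i) →
        Set.BijOn (fun x : M.carrier => (MvPolynomial.monomial m 1 : Pol K n) • x)
          (M.deg a) (M.deg (a + Family.expo m)))
      (hm' : ∀ a : Deg n, (∀ i, 0 < m' i → (t i : ℤ) ≤ a i) →
        Set.BijOn (fun x : M.carrier => (MvPolynomial.monomial m' 1 : Pol K n) • x)
          (M.deg a) (M.deg (a + Family.expo m'))) (a : Deg n)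
      (ha : ∀ i, 0 < (m + m') i → (t i : ℤ) ≤ a i) :
      Set.BijOn (fun x : M.carrier => (MvPolynomial.monomial (m + m') 1 : Pol K n) • x)
        (M.deg a) (M.deg (a + Family.expo (m + m'))) := by
    have h1 := hm a fun i hi => ha i (by rw [Finsupp.add_apply]; omega)
    have h2 := hm' (a + Family.expo m) fun i hi =>
      (ha i (by rw [Finsupp.add_apply]; omega)).trans
        (le_add_of_nonneg_right (expo_nonneg m i))
    have h3 := h2.comp h1
    rw [add_assoc, ← expo_add] at h3
    refine h3.congr fun x _ => ?_
    change (MvPolynomial.monomial m' 1 : Pol K n) • (MvPolynomial.monomial m 1 : Pol K n) • x = _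
    rw [smul_smul, MvPolynomial.monomial_mul, one_mul, add_comm m']
  have zero (a : Deg n) : Set.BijOn
      (fun x : M.carrier => (MvPolynomial.monomial 0 1 : Pol K n) • x)
        (M.deg a) (M.deg (a + Family.expo 0)) := by
    have e : a + Family.expo 0 = a := by ext i; simp [Family.expo]
    rw [e]
    refine (Set.bijOn_id _).congr fun x _ => ?_
    change x = (1 : Pol K n) • x
    rw [one_smul]
  induction m using Finsupp.induction_linear with
  | zero => exact fun a _ => zero a
  | add m m' hm hm' => exact add m m' hm hm'
  | single i k =>
    induction k with
    | zero => rw [Finsupp.single_zero]; exact fun a _ => zero a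
    | succ k ih =>
      rw [Finsupp.single_add]
      refine add _ _ ih fun a ha => ?_
      have : Family.expo (Finsupp.single i 1) = varDeg n i := by
        ext j; by_cases hj : i = j
        · subst hj; simp [Family.expo, varDeg]
        · simp [Family.expo, varDeg, Ne.symm hj]
      rw [this]
      exact h.bijOn a i (ha i (by simp))

/-- In a `t`-determined module, `x^{b - a} : M_a → M_b` is bijective if `a` and `b` differ only in
coordinates where `a_i ≥ t_i`. -/
theorem Determined.bijOn_mono (h : Determined t M) {a b : Deg n} (hab : a ≤ b)
    (ht : ∀ i, a i < b i → (t i : ℤ) ≤ a i) :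
    Set.BijOn (fun x : M.carrier => mono K (b - a) • x) (M.deg a) (M.deg b) := by
  obtain ⟨m, hm⟩ := exists_expo (sub_nonneg.2 hab)
  have := h.bijOn_monomial m a fun i hi => ht i (by
    have := congrFun hm i
    simp only [Family.expo, Pi.sub_apply] at this
    omega)
  rwa [← mono_expo, hm, add_sub_cancel] at this

theorem Determined.exists_mono_smul_eq (h : Determined t M) {a b : Deg n} (hab : a ≤ b)
    (ht : ∀ i, a i < b i → (t i : ℤ) ≤ a i) {x : M.carrier} (hx : x ∈ M.deg b) :
    ∃ y ∈ M.deg a, mono K (b - a) • y = x :=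
  (h.bijOn_mono hab ht).surjOn hx

/-- The components of a finitely generated graded module are finite-dimensional: if `M` is
generated by `G`, then `M_b` is spanned by the `x^{b - a} g_a`, for `g ∈ G` and the finitely many
nonzero components `g_a` of `g`. -/
theorem finiteDimensional_deg (M : GrMod K n) [Module.Finite (Pol K n) M.carrier] (b : Deg n) :
    FiniteDimensional K (M.deg b) := by
  classical
  let _ := M.isInternal.chooseDecomposition
  obtain ⟨G, hG⟩ := (Module.Finite.fg_top : (⊤ : Submodule (Pol K n) M.carrier).FG)
  let T : Finset M.carrier := G.biUnion fun g =>
    (DirectSum.decompose M.deg g).support.image fun a =>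
      mono K (b - a) • (DirectSum.decompose M.deg g a : M.carrier)
  have key (x : M.carrier) (p : Pol K n) :
      (DirectSum.decompose M.deg (p • x) b : M.carrier) ∈ Submodule.span K (T : Set M.carrier) := by
    have hx : x ∈ Submodule.span (Pol K n) (G : Set M.carrier) := hG ▸ Submodule.mem_top
    induction hx using Submodule.span_induction generalizing p with
    | zero => simp
    | add x y _ _ hx hy =>
      rw [smul_add, DirectSum.decompose_add, DirectSum.add_apply, Submodule.coe_add]
      exact add_mem (hx p) (hy p)
    | smul q x _ hx => rw [smul_smul]; exact hx _
    | mem g hg =>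
      rw [← DirectSum.sum_support_decompose M.deg g, Finset.smul_sum, DirectSum.decompose_sum,
        DFinsupp.finsetSum_apply, AddSubmonoidClass.coe_finsetSum]
      refine Submodule.sum_mem _ fun a ha => ?_
      induction p using MvPolynomial.induction_on' with
      | add p q hp hq =>
        rw [add_smul, DirectSum.decompose_add, DirectSum.add_apply, Submodule.coe_add]
        exact add_mem hp hq
      | monomial m c =>
        have hm := M.smul_mem (monomial_mem m c) (DirectSum.decompose M.deg g a).2
        by_cases hb : Family.expo m + a = b
        · rw [← hb, DirectSum.decompose_of_mem_same _ hm]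
          have : MvPolynomial.monomial m c = c • mono K (b - a) := by
            rw [← hb, add_sub_cancel_right, mono_expo, MvPolynomial.smul_monomial, smul_eq_mul,
              mul_one]
          rw [this, smul_assoc]
          exact Submodule.smul_mem _ _ (Submodule.subset_span
            (Finset.mem_biUnion.2 ⟨g, hg, Finset.mem_image.2 ⟨a, ha, rfl⟩⟩))
        · rw [DirectSum.decompose_of_mem_ne _ hm hb]
          exact zero_mem _
  refine Submodule.finiteDimensional_of_le (S₂ := Submodule.span K (T : Set M.carrier))
    fun x hx => ?_
  have := key x 1
  rwa [one_smul, DirectSum.decompose_of_mem_same _ hx] at this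

/-- A `t`-determined module is generated by its components in the box `0 ≤ a ≤ t`. -/
theorem Determined.finite (h : Determined t M) (hM : ∀ a, FiniteDimensional K (M.deg a)) :
    Module.Finite (Pol K n) M.carrier := by
  have hfg (a : Deg n) : (M.deg a).FG := (Submodule.fg_iff_finiteDimensional _).2 (hM a)
  choose T hT using hfg
  let t' : Deg n := fun i => t i
  have hfin : (⋃ a ∈ Set.Icc 0 t', (T a : Set M.carrier)).Finite :=
    (Set.finite_Icc 0 t').biUnion fun a _ => (T a).finite_toSet
  have key : ∀ a ∈ Set.Icc 0 t', ∀ x ∈ M.deg a,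
      x ∈ Submodule.span (Pol K n) (⋃ a ∈ Set.Icc 0 t', (T a : Set M.carrier)) := by
    intro a ha x hx
    rw [← hT a] at hx
    exact Submodule.span_subset_span K (Pol K n) _
      (Submodule.span_mono (Set.subset_biUnion_of_mem ha) hx)
  refine ⟨Submodule.fg_def.2 ⟨_, hfin, eq_top_iff.2 fun x _ => ?_⟩⟩
  induction x using induction_deg with
  | zero => exact zero_mem _
  | add x y hx hy => exact add_mem (hx trivial) (hy trivial)
  | deg b x hx =>
    by_cases hb : 0 ≤ b
    · obtain ⟨y, hy, rfl⟩ := h.exists_mono_smul_eq (a := b ⊓ t') inf_le_left (fun i hi => by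
        simp only [Pi.inf_apply, t'] at hi ⊢; omega) hx
      exact Submodule.smul_mem _ _
        (key _ ⟨le_inf hb fun i => by simp [t'], inf_le_right⟩ y hy)
    · rw [h.eq_bot b hb, Submodule.mem_bot] at hx
      rw [hx]; exact zero_mem _

theorem posDet_iff : PosDet K t M ↔ Determined t M ∧ ∀ a, FiniteDimensional K (M.deg a) :=
  ⟨fun h => ⟨⟨h.2.1, h.2.2⟩, let _ := h.1; M.finiteDimensional_deg⟩,
    fun h => ⟨h.1.finite h.2, h.1.eq_bot, h.1.bijOn⟩⟩

section
variable {V : Type*} [AddCommGroup V] [Module K V]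

/-- An equivariant map out of a `t`-determined module is determined by its restriction to
`M_t`, since `M_t → M_{b ⊔ t}` is surjective for all `b`. -/
theorem Determined.eq_zero_of_equivariant (h : Determined t M) {φ : M.carrier →ₗ[K] V}
    (hφ : Equivariant φ) (h0 : ∀ x ∈ M.deg fun i => t i, φ x = 0) : φ = 0 := by
  refine linearMap_ext_deg fun b x hx => ?_
  rw [LinearMap.zero_apply, ← hφ.mono_smul (b ⊔ (fun i => (t i : ℤ)) - b)]
  obtain ⟨y, hy, e⟩ := h.exists_mono_smul_eq (a := fun i => (t i : ℤ))
    (b := b ⊔ fun i => (t i : ℤ)) le_sup_right (fun _ _ => le_rfl)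
    (M.mono_smul_mem le_sup_left hx)
  rw [← e, hφ.mono_smul, h0 y hy]

/-- Every linear map on the component `M_t` of a `t`-determined module extends to an equivariant
map on `M`, which is given on `M_b` by `M_b → M_{b ⊔ t} ≅ M_t`. -/
theorem Determined.exists_equivariant (h : Determined t M)
    (g : (M.deg fun i => t i) →ₗ[K] V) :
    ∃ φ : M.carrier →ₗ[K] V, Equivariant φ ∧ ∀ x : M.deg fun i => t i, φ x = g x := by
  let t' : Deg n := fun i => t i
  let mul {a b : Deg n} (hab : a ≤ b) : M.deg a →ₗ[K] M.deg b :=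
    (LinearMap.lsmul (Pol K n) M.carrier (mono K (b - a)) |>.restrictScalars K).restrict
      fun x hx => M.mono_smul_mem hab hx
  have bij (b : Deg n) (hb : t' ≤ b) : Function.Bijective (mul hb) := by
    have := h.bijOn_mono hb fun _ _ => le_rfl
    refine ⟨fun x y e => Subtype.ext (this.injOn x.2 y.2 (congrArg Subtype.val e)), fun y => ?_⟩
    obtain ⟨x, hx, e⟩ := this.surjOn y.2
    exact ⟨⟨x, hx⟩, Subtype.ext e⟩
  let e (b : Deg n) (hb : t' ≤ b) : M.deg t' ≃ₗ[K] M.deg b := LinearEquiv.ofBijective _ (bij b hb)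
  obtain ⟨φ, hφ⟩ := exists_linearMap fun b =>
    g ∘ₗ (e (b ⊔ t') le_sup_right).symm.toLinearMap ∘ₗ mul (le_sup_left (b := t'))
  -- The value of `φ` on `M_b` can be computed in any `M_c` with `c ≥ b ⊔ t`, since
  -- `M_{b ⊔ t} → M_c` is injective.
  have key {b c : Deg n} (hbc : b ≤ c) (hc : t' ≤ c) {x : M.carrier} (hx : x ∈ M.deg b)
      (y : M.deg t') (hy : mono K (c - t') • y.1 = mono K (c - b) • x) : φ x = g y := by
    rw [show φ x = _ from hφ b ⟨x, hx⟩]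
    refine congrArg g ((LinearEquiv.symm_apply_eq _).2 ?_)
    have hbt : b ⊔ t' ≤ c := sup_le hbc hc
    refine Subtype.ext ((h.bijOn_mono hbt fun i hi => ?_).injOn
      (M.mono_smul_mem le_sup_left hx) (M.mono_smul_mem le_sup_right y.2) ?_)
    · exact le_sup_right (a := b i)
    · change mono K (c - b ⊔ t') • mono K (b ⊔ t' - b) • x =
        mono K (c - b ⊔ t') • mono K (b ⊔ t' - t') • y.1
      rw [smul_smul, smul_smul, ← mono_add K (sub_nonneg.2 hbt) (sub_nonneg.2 le_sup_left),
        ← mono_add K (sub_nonneg.2 hbt) (sub_nonneg.2 le_sup_right), sub_add_sub_cancel,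
        sub_add_sub_cancel, hy]
  refine ⟨φ, Equivariant.of_mono fun d hd b x hx => ?_, fun x => key le_rfl le_rfl x.2 x rfl⟩
  have hb : b ≤ d + b := le_add_of_nonneg_left hd
  have hdx : mono K d • x ∈ M.deg (d + b) := M.smul_mem (mono_mem K hd) hx
  obtain ⟨y, hy, e⟩ := h.exists_mono_smul_eq (a := t') (b := (d + b) ⊔ t') le_sup_right
    (fun _ _ => le_rfl) (M.mono_smul_mem le_sup_left hdx)
  rw [key le_sup_left le_sup_right hdx ⟨y, hy⟩ e,
    key (hb.trans le_sup_left) le_sup_right hx ⟨y, hy⟩]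
  rw [e, smul_smul, ← mono_add K (sub_nonneg.2 le_sup_left) hd]
  congr 2
  abel

end

end determined

end GrMod
end MultiGr

namespace MultiGr

theorem Family.mono_smul_incl {K : Type u} [Field K] {n : ℕ} (F : Family K n) {a b : Deg n}
    (h : a ≤ b) (x : F.obj a) :
    mono K (b - a) • F.incl a x = F.incl b (F.map h x) := by
  obtain ⟨m, hm⟩ := exists_expo (sub_nonneg.2 h)
  rw [← hm, mono_expo, F.monomial_smul_incl, one_smul]
  exact F.incl_map_congr _ _ (by rw [hm, sub_add_cancel]) x

namespace GrMod
variable {K : Type u} [Field K] {n : ℕ}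

/-! ### Reindexed modules -/

section underlying
variable (c : Deg n) (q : Deg n → Deg n) (hq : MonotoneOn q (Set.Ici c))

/-- The map from the reindexed module to `M` that is the inclusion `M_{q(b)} → M` on the component
of degree `b`. It is only `K`-linear. -/
noncomputable def underlying (M : GrMod K n) :
    ((reindex c q hq).obj M).carrier →ₗ[K] M.carrier :=
  ((reindexFamily c q hq).obj M).desc fun b => (M.reindexDeg c q b).subtype

/-- The inclusion of a component of the reindexed module. The type of its values is the carrier of
`(reindex c q hq).obj M`, which agrees with that of `Family.incl` only after unfolding. -/
noncomputable def reindexIncl (M : GrMod K n) (b : Deg n) :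
    M.reindexDeg c q b →ₗ[K] ((reindex c q hq).obj M).carrier :=
  ((reindexFamily c q hq).obj M).incl b

theorem exists_reindexIncl {M : GrMod K n} {b : Deg n} {x : ((reindex c q hq).obj M).carrier}
    (hx : x ∈ ((reindex c q hq).obj M).deg b) : ∃ y, reindexIncl c q hq M b y = x :=
  hx

theorem reindexIncl_mem (M : GrMod K n) (b : Deg n) (y : M.reindexDeg c q b) :
    reindexIncl c q hq M b y ∈ ((reindex c q hq).obj M).deg b :=
  ⟨y, rfl⟩

theorem mono_smul_reindexIncl (M : GrMod K n) {a b : Deg n} (h : a ≤ b)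
    (y : M.reindexDeg c q a) :
    mono K (b - a) • reindexIncl c q hq M a y =
      reindexIncl c q hq M b (M.reindexMap c q hq h y) :=
  ((reindexFamily c q hq).obj M).mono_smul_incl h y

theorem map_reindexIncl {M N : GrMod K n} (f : M ⟶ N) (b : Deg n) (y : M.reindexDeg c q b) :
    ∃ z : N.reindexDeg c q b, z.1 = Hom.lin f y.1 ∧
      Hom.lin ((reindex c q hq).map f) (reindexIncl c q hq M b y) = reindexIncl c q hq N b z :=
  let F := (reindexFamily c q hq).map f
  ⟨F.app b y, rfl, Family.homMk_incl F.app F.comm b y⟩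

theorem underlying_incl (M : GrMod K n) (b : Deg n) (y : M.reindexDeg c q b) :
    underlying c q hq M (reindexIncl c q hq M b y) = y :=
  Family.desc_incl ((reindexFamily c q hq).obj M) (fun b => (M.reindexDeg c q b).subtype) b y

theorem map_underlying (M : GrMod K n) (b : Deg n) :
    (((reindex c q hq).obj M).deg b).map (underlying c q hq M) = M.reindexDeg c q b := by
  ext x
  constructor
  · rintro ⟨_, hy, rfl⟩
    obtain ⟨y, rfl⟩ := exists_reindexIncl c q hq hy
    rw [underlying_incl]
    exact y.2
  · exact fun hx => ⟨_, reindexIncl_mem c q hq M b ⟨x, hx⟩, underlying_incl c q hq M b ⟨x, hx⟩⟩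

theorem underlying_injOn (M : GrMod K n) (b : Deg n) {x : ((reindex c q hq).obj M).carrier}
    (hx : x ∈ ((reindex c q hq).obj M).deg b) (h : underlying c q hq M x = 0) : x = 0 := by
  obtain ⟨y, rfl⟩ := exists_reindexIncl c q hq hx
  rw [underlying_incl] at h
  rw [show y = 0 from Subtype.ext h, map_zero]

theorem underlying_mono_smul (M : GrMod K n) {a b : Deg n} (h : a ≤ b)
    {x : ((reindex c q hq).obj M).carrier} (hx : x ∈ ((reindex c q hq).obj M).deg a) :
    underlying c q hq M (mono K (b - a) • x) = mono K (q b - q a) • underlying c q hq M x := by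
  obtain ⟨y, rfl⟩ := exists_reindexIncl c q hq hx
  rw [underlying_incl, mono_smul_reindexIncl c q hq M h, underlying_incl]
  rfl

theorem underlying_map {M N : GrMod K n} (f : M ⟶ N) (x : ((reindex c q hq).obj M).carrier) :
    underlying c q hq N (Hom.lin ((reindex c q hq).map f) x) =
      Hom.lin f (underlying c q hq M x) := by
  induction x using induction_deg with
  | zero => simp only [map_zero]
  | add x y hx hy => simp only [map_add, hx, hy]
  | deg b x hx =>
    obtain ⟨y, rfl⟩ := exists_reindexIncl c q hq hx
    obtain ⟨z, hz, e⟩ := map_reindexIncl c q hq f b y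
    rw [underlying_incl, e, underlying_incl, hz]

variable {V : Type*} [AddCommGroup V] [Module K V]

theorem Equivariant.comp_underlying {M : GrMod K n} {φ : M.carrier →ₗ[K] V}
    (hφ : Equivariant φ) : Equivariant (φ ∘ₗ underlying c q hq M) :=
  Equivariant.of_mono fun d hd a x hx => by
    have := underlying_mono_smul c q hq M (le_add_of_nonneg_right hd : a ≤ a + d) hx
    rw [add_sub_cancel_left] at this
    rw [LinearMap.comp_apply, LinearMap.comp_apply, this, hφ.mono_smul]

theorem IsRealization.comp_underlying {M : GrMod K n} {φ : M.carrier →ₗ[K] V}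
    (hφ : IsRealization φ) : IsRealization (φ ∘ₗ underlying c q hq M) where
  equivariant := hφ.equivariant.comp_underlying c q hq
  injOn b x hx h := by
    refine underlying_injOn c q hq M b hx (hφ.injOn (q b) _ ?_ h)
    have : underlying c q hq M x ∈ M.reindexDeg c q b :=
      map_underlying c q hq M b ▸ Submodule.mem_map_of_mem hx
    by_cases hb : c ≤ b
    · exact this.1 hb
    · rw [this.2 hb]; exact zero_mem _

end underlying

/-! ### The functors `q^*` -/

section pull
variable (q : (Fin n → ℕ) →o Deg n)

/-- The map `q^* M → M` given by the inclusions `M_{q(b)} → M`. -/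
noncomputable abbrev pullUnderlying (M : GrMod K n) :
    ((pull q).obj M).carrier →ₗ[K] M.carrier :=
  underlying 0 (fun b => q fun i => (b i).toNat)
    (fun _ _ _ _ h => q.monotone fun i => Int.toNat_le_toNat (h i)) M

theorem eq_of_pullUnderlying_eq {M : GrMod K n} {b : Deg n} {x y : ((pull q).obj M).carrier}
    (hx : x ∈ ((pull q).obj M).deg b) (hy : y ∈ ((pull q).obj M).deg b)
    (h : pullUnderlying q M x = pullUnderlying q M y) : x = y :=
  sub_eq_zero.1 <| underlying_injOn _ _ _ M b (sub_mem hx hy)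
    ((map_sub (pullUnderlying q M) x y).trans (sub_eq_zero.2 h))

theorem pullUnderlying_mem {M : GrMod K n} {b : Deg n} {x : ((pull q).obj M).carrier}
    (hx : x ∈ ((pull q).obj M).deg b) :
    (0 ≤ b → pullUnderlying q M x ∈ M.deg (q fun i => (b i).toNat)) ∧
      (¬ 0 ≤ b → pullUnderlying q M x = 0) := by
  have : pullUnderlying q M x ∈ M.reindexDeg 0 (fun b => q fun i => (b i).toNat) b := by
    rw [← map_underlying]
    exact Submodule.mem_map_of_mem hx
  exact this

theorem exists_pullUnderlying_eq {M : GrMod K n} {b : Deg n} (hb : 0 ≤ b) {x : M.carrier}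
    (hx : x ∈ M.deg (q fun i => (b i).toNat)) :
    ∃ y ∈ ((pull q).obj M).deg b, pullUnderlying q M y = x := by
  have : x ∈ M.reindexDeg 0 (fun b => q fun i => (b i).toNat) b :=
    ⟨fun _ => hx, fun h => (h hb).elim⟩
  rw [← map_underlying 0 _
    (fun _ _ _ _ h => q.monotone fun i => Int.toNat_le_toNat (h i))] at this
  exact this

variable {q}

/-- If `q(b)` does not change when a positive coordinate of `b` grows, then every `q^* M` is
`1`-determined: `x_i` acts on `(q^* M)_b = M_{q(b)}` as the identity whenever `b_i ≥ 1`. -/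
theorem pull_determined (hq : ∀ b i, 1 ≤ b i → q (b + Pi.single i 1) = q b) (M : GrMod K n) :
    Determined 1 ((pull q).obj M) where
  eq_bot a ha := eq_bot_iff.2 fun x hx =>
    underlying_injOn _ _ _ M a hx ((pullUnderlying_mem q hx).2 ha)
  bijOn a i hi := by
    have hi' : 1 ≤ a i := by simpa using hi
    have hle : a ≤ a + varDeg n i := fun j => by
      by_cases h : j = i
      · subst h; simp [varDeg]
      · simp [varDeg, h]
    have hqa : (q fun j => ((a + varDeg n i) j).toNat) = q fun j => (a j).toNat := by
      rw [← hq (fun j => (a j).toNat) i (by omega)]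
      congr 1
      ext j
      by_cases h : j = i
      · subst h; simp [varDeg]; omega
      · simp [varDeg, h]
    have h0 : 0 ≤ a ↔ 0 ≤ a + varDeg n i := by
      refine ⟨fun h => h.trans hle, fun h j => ?_⟩
      by_cases hj : j = i
      · subst hj; simp; omega
      · simpa [varDeg, hj] using h j
    have hX (x : ((pull q).obj M).carrier) (hx : x ∈ ((pull q).obj M).deg a) :
        (MvPolynomial.X i : Pol K n) • x ∈ ((pull q).obj M).deg (a + varDeg n i) ∧
        pullUnderlying q M ((MvPolynomial.X i : Pol K n) • x) = pullUnderlying q M x := by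
      rw [← mono_varDeg, show varDeg n i = (a + varDeg n i) - a by abel]
      have h1 := mono_smul_mem _ hle hx
      have h2 := underlying_mono_smul 0 _
        (fun _ _ _ _ h => q.monotone fun i => Int.toNat_le_toNat (h i)) M hle hx
      rw [hqa, sub_self, mono_zero, one_smul] at h2
      rw [add_sub_cancel_left] at *
      exact ⟨h1, h2⟩
    refine ⟨fun x hx => (hX x hx).1, fun x hx y hy e => ?_, fun y hy => ?_⟩
    · refine eq_of_pullUnderlying_eq q hx hy ?_
      exact (hX x hx).2.symm.trans ((congrArg (pullUnderlying q M) e).trans (hX y hy).2)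
    · by_cases ha : 0 ≤ a
      · obtain ⟨x, hx, e⟩ := exists_pullUnderlying_eq (M := M) q ha
          (hqa ▸ (pullUnderlying_mem q hy).1 (h0.1 ha))
        exact ⟨x, hx, eq_of_pullUnderlying_eq q (hX x hx).1 hy ((hX x hx).2.trans e)⟩
      · refine ⟨0, zero_mem _, ?_⟩
        rw [underlying_injOn _ _ _ M _ hy ((pullUnderlying_mem q hy).2 fun h => ha (h0.2 h))]
        exact smul_zero _

theorem pull_finiteDimensional {M : GrMod K n} (hM : ∀ a, FiniteDimensional K (M.deg a))
    (b : Deg n) : FiniteDimensional K (((pull q).obj M).deg b) := by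
  by_cases hb : 0 ≤ b
  · exact FiniteDimensional.of_injective
      ((pullUnderlying q M).restrict fun x hx => (pullUnderlying_mem q hx).1 hb)
      ((injective_iff_map_eq_zero _).2 fun x hx =>
        Subtype.ext (underlying_injOn _ _ _ M b x.2 (congrArg Subtype.val hx)))
  · have : ((pull q).obj M).deg b = ⊥ := eq_bot_iff.2 fun x hx =>
      underlying_injOn _ _ _ M b hx ((pullUnderlying_mem q hx).2 hb)
    rw [this]
    infer_instance

end pull

/-! ### The dual of a graded module as a space of functionals -/

section dual
open Opposite

/-- `S(a)` is realized in `K` by the augmentation; its nonzero components all become `K`. -/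
theorem aug_isRealization (a : Deg n) :
    IsRealization (M := (free K n).twist a) (aug K (n := n)).toLinearMap where
  equivariant p x := map_mul (aug K) p x
  injOn b x hx h := by
    rw [eq_aug_smul_mono hx]
    exact (congrArg (· • _) h).trans (zero_smul _ _)

/-- Composition of `f ∈ Hom(M, S(a))` with the augmentation, as a functional on `M`. -/
noncomputable def augComp (M : GrMod K n) (a : Deg n) :
    M.homDeg (free K n) a →ₗ[K] Module.Dual K M.carrier where
  toFun f := (aug K).toLinearMap ∘ₗ f.1.restrictScalars K
  map_add' _ _ := LinearMap.ext fun _ => map_add (aug K) _ _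
  map_smul' _ _ := LinearMap.ext fun _ => map_smul (aug K) _ _

theorem augComp_injective (M : GrMod K n) (a : Deg n) : Function.Injective (augComp M a) := by
  refine (injective_iff_map_eq_zero _).2 fun f hf => Subtype.ext (LinearMap.ext fun x => ?_)
  induction x using induction_deg with
  | zero => exact map_zero _
  | add x y hx hy => rw [map_add, hx, hy, map_add]
  | deg b x hx => exact (aug_isRealization a).injOn b _ (f.2 b x hx) (LinearMap.congr_fun hf x)

/-- `Hom(M, S(a))` is identified with the equivariant functionals on `M` that vanish on all `M_b`
with `S_{a + b} = 0`. -/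
theorem mem_range_augComp (M : GrMod K n) (a : Deg n) (φ : Module.Dual K M.carrier) :
    φ ∈ LinearMap.range (augComp M a) ↔
      Equivariant φ ∧ ∀ b, ¬ 0 ≤ a + b → ∀ x ∈ M.deg b, φ x = 0 := by
  constructor
  · rintro ⟨f, rfl⟩
    refine ⟨fun p x => ?_, fun b hb x hx => ?_⟩
    · change aug K (f.1 (p • x)) = aug K p • aug K (f.1 x)
      rw [map_smul, smul_eq_mul, smul_eq_mul, map_mul]
    · change aug K (f.1 x) = 0
      rw [eq_zero_of_not_nonneg hb (f.2 b x hx), map_zero]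
  · rintro ⟨hφ, h⟩
    obtain ⟨f, hf⟩ := (aug_isRealization (K := K) a).exists_lift hφ fun b => by
      rintro _ ⟨x, hx, rfl⟩
      by_cases hb : 0 ≤ a + b
      · exact ⟨φ x • mono K (a + b), Submodule.smul_mem _ _ (mono_mem K hb), by
          change aug K (φ x • mono K (a + b)) = φ x
          rw [map_smul, aug_mono, smul_eq_mul, mul_one]⟩
      · rw [h b hb x hx]; exact zero_mem _
    exact ⟨⟨Hom.lin (N := (free K n).twist a) f, fun b x hx => Hom.map_mem f hx⟩, LinearMap.ext hf⟩

variable (c : Fin n → ℕ)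

/-- The realization of the graded module `D_c M` in the dual space of `M`. -/
noncomputable def dualEval (M : GrMod K n) :
    ((dual K c).obj (op M)).carrier →ₗ[K] Module.Dual K M.carrier :=
  ((homFamily (free K n)).obj (op M)).desc fun a => augComp M a

/-- The inclusion of the component of degree `a` of `D_c M`, which is `Hom(M, S(a - c))`. -/
noncomputable def dualIncl (M : GrMod K n) (a : Deg n) :
    M.homDeg (free K n) ((-fun i => (c i : ℤ)) + a) →ₗ[K] ((dual K c).obj (op M)).carrier :=
  ((homFamily (free K n)).obj (op M)).incl _

theorem exists_dualIncl {M : GrMod K n} {a : Deg n} {x : ((dual K c).obj (op M)).carrier}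
    (hx : x ∈ ((dual K c).obj (op M)).deg a) : ∃ f, dualIncl c M a f = x :=
  hx

theorem dualIncl_mem (M : GrMod K n) (a : Deg n)
    (f : M.homDeg (free K n) ((-fun i => (c i : ℤ)) + a)) :
    dualIncl c M a f ∈ ((dual K c).obj (op M)).deg a :=
  ⟨f, rfl⟩

theorem dualEval_incl (M : GrMod K n) (a : Deg n)
    (f : M.homDeg (free K n) ((-fun i => (c i : ℤ)) + a)) :
    dualEval c M (dualIncl c M a f) = augComp M _ f :=
  Family.desc_incl ((homFamily (free K n)).obj (op M)) (fun a => augComp M a) _ f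

/-- The component of degree `a` of `D_c M` consists of the equivariant functionals on `M` that
vanish on `M_b` unless `b ≥ c - a`. -/
theorem mem_map_dualEval (M : GrMod K n) (a : Deg n) (φ : Module.Dual K M.carrier) :
    φ ∈ (((dual K c).obj (op M)).deg a).map (dualEval c M) ↔
      Equivariant φ ∧ ∀ b : Deg n, ¬ (fun i => (c i : ℤ)) - a ≤ b → ∀ x ∈ M.deg b, φ x = 0 := by
  have e (b : Deg n) : 0 ≤ (-fun i => (c i : ℤ)) + a + b ↔ (fun i => (c i : ℤ)) - a ≤ b := by
    rw [← sub_nonneg (a := b),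
      show b - ((fun i => (c i : ℤ)) - a) = (-fun i => (c i : ℤ)) + a + b by abel]
  simp only [← e]
  rw [← mem_range_augComp]
  constructor
  · rintro ⟨_, hf, rfl⟩
    obtain ⟨f, rfl⟩ := exists_dualIncl c hf
    exact ⟨f, (dualEval_incl c M _ f).symm⟩
  · rintro ⟨f, rfl⟩
    exact ⟨_, dualIncl_mem c M a f, dualEval_incl c M _ f⟩

theorem mono_smul_dualIncl (M : GrMod K n) {d : Deg n} (hd : 0 ≤ d) (a : Deg n)
    (f : M.homDeg (free K n) ((-fun i => (c i : ℤ)) + a)) :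
    ∃ g : M.homDeg (free K n) ((-fun i => (c i : ℤ)) + (a + d)),
      g.1 = mono K d • f.1 ∧ mono K d • dualIncl c M a f = dualIncl c M (a + d) g := by
  have hle : (-fun i => (c i : ℤ)) + a ≤ (-fun i => (c i : ℤ)) + (a + d) :=
    add_le_add_right (le_add_of_nonneg_right hd) _
  have e : (-fun i => (c i : ℤ)) + (a + d) - ((-fun i => (c i : ℤ)) + a) = d := by abel
  refine ⟨((homFamily (free K n)).obj (op M)).map hle f,
    congrArg (fun d => mono K d • f.1) e, ?_⟩
  have h := ((homFamily (free K n)).obj (op M)).mono_smul_incl hle f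
  rw [e] at h
  exact h

theorem dualEval_isRealization (M : GrMod K n) : IsRealization (dualEval c M) where
  equivariant := Equivariant.of_mono fun d hd a x hx => by
    obtain ⟨f, rfl⟩ := exists_dualIncl c hx
    obtain ⟨g, hg, e⟩ := mono_smul_dualIncl c M hd a f
    rw [e, dualEval_incl, dualEval_incl]
    refine LinearMap.ext fun x => ?_
    change aug K (g.1 x) = aug K (f.1 x)
    rw [hg, LinearMap.smul_apply, smul_eq_mul, map_mul, aug_mono, one_mul]
  injOn a x hx h := by
    obtain ⟨f, rfl⟩ := exists_dualIncl c hx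
    rw [dualEval_incl] at h
    rw [augComp_injective M _ (h.trans (map_zero _).symm), map_zero]

theorem map_dualIncl {M N : GrMod K n} (u : M ⟶ N) (a : Deg n)
    (f : N.homDeg (free K n) ((-fun i => (c i : ℤ)) + a)) :
    ∃ g : M.homDeg (free K n) ((-fun i => (c i : ℤ)) + a), g.1 = f.1 ∘ₗ Hom.lin u ∧
      Hom.lin ((dual K c).map u.op) (dualIncl c N a f) = dualIncl c M a g :=
  let F := (homFamily (free K n)).map u.op
  ⟨F.app _ f, rfl, Family.homMk_incl F.app F.comm _ f⟩

theorem dualEval_map {M N : GrMod K n} (u : M ⟶ N) (y : ((dual K c).obj (op N)).carrier) :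
    dualEval c M (Hom.lin ((dual K c).map u.op) y) =
      dualEval c N y ∘ₗ (Hom.lin u).restrictScalars K := by
  induction y using induction_deg with
  | zero => simp only [map_zero, LinearMap.zero_comp]
  | add x y hx hy => simp only [map_add, hx, hy, LinearMap.add_comp]
  | deg b y hy =>
    obtain ⟨f, rfl⟩ := exists_dualIncl c hy
    obtain ⟨g, hg, e⟩ := map_dualIncl c u b f
    rw [dualEval_incl, e, dualEval_incl]
    refine LinearMap.ext fun x => ?_
    change aug K (g.1 x) = aug K (f.1 (Hom.lin u x))
    rw [hg, LinearMap.comp_apply]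

end dual

open Opposite

theorem reindexDeg_of_le (M : GrMod K n) {c : Deg n} (q : Deg n → Deg n) {b : Deg n}
    (h : c ≤ b) : M.reindexDeg c q b = M.deg (q b) :=
  Submodule.ext fun _ => ⟨fun hx => hx.1 h, fun hx => ⟨fun _ => hx, fun h' => (h' h).elim⟩⟩

theorem reindexDeg_of_not_le (M : GrMod K n) {c : Deg n} (q : Deg n → Deg n) {b : Deg n}
    (h : ¬ c ≤ b) : M.reindexDeg c q b = ⊥ :=
  eq_bot_iff.2 fun _ hx => hx.2 h

/-- Whether a graded module is positively `t`-determined can be read off from the subspaces of a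
realization. -/
theorem IsRealization.posDet_iff {V : Type*} [AddCommGroup V] [Module K V] {M : GrMod K n}
    {ρ : M.carrier →ₗ[K] V} (hρ : IsRealization ρ) (t : Fin n → ℕ) :
    PosDet K t M ↔ (∀ a : Deg n, ¬ 0 ≤ a → (M.deg a).map ρ = ⊥) ∧
      (∀ (a : Deg n) (i : Fin n), (t i : ℤ) ≤ a i →
        (M.deg (a + varDeg n i)).map ρ ≤ (M.deg a).map ρ) ∧
      ∀ a, FiniteDimensional K ((M.deg a).map ρ) := by
  have inj (a : Deg n) : Function.Injective (ρ.submoduleMap (M.deg a)) := fun x y e =>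
    Subtype.ext (hρ.eq_of_apply_eq x.2 y.2 (congrArg Subtype.val e))
  have smul_mem {a : Deg n} (i : Fin n) {x : M.carrier} (hx : x ∈ M.deg a) :
      (MvPolynomial.X i : Pol K n) • x ∈ M.deg (a + varDeg n i) := by
    rw [← mono_varDeg, add_comm]
    refine M.smul_mem (mono_mem K fun j => ?_) hx
    by_cases h : j = i
    · subst h; simp [varDeg]
    · simp [varDeg, h]
  have apply_smul (i : Fin n) (x : M.carrier) : ρ ((MvPolynomial.X i : Pol K n) • x) = ρ x := by
    rw [hρ.equivariant, aug_X, one_smul]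
  rw [GrMod.posDet_iff]
  refine ⟨fun h => ⟨fun a ha => by rw [h.1.eq_bot a ha, Submodule.map_bot], fun a i ha => ?_,
    fun a => ?_⟩, fun h => ⟨⟨fun a ha => ?_, fun a i ha => ⟨fun x hx => smul_mem i hx,
      fun x hx y hy e => ?_, fun y hy => ?_⟩⟩, fun a => ?_⟩⟩
  · rintro _ ⟨y, hy, rfl⟩
    obtain ⟨x, hx, rfl⟩ := (h.1.bijOn a i ha).surjOn hy
    exact ⟨x, hx, (apply_smul i x).symm⟩
  · have := h.2 a
    infer_instance
  · exact eq_bot_iff.2 fun x hx => hρ.injOn a x hx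
      ((Submodule.mem_bot K).1 (h.1 a ha ▸ Submodule.mem_map_of_mem hx))
  · refine hρ.eq_of_apply_eq hx hy ?_
    rw [← apply_smul i x, ← apply_smul i y]
    exact congrArg ρ e
  · obtain ⟨x, hx, e⟩ := h.2.1 a i ha ⟨y, hy, rfl⟩
    exact ⟨x, hx, hρ.eq_of_apply_eq (smul_mem i hx) hy ((apply_smul i x).trans e)⟩
  · have := h.2.2 a
    exact FiniteDimensional.of_injective _ (inj a)

/-- The duality `D_t` preserves positively `t`-determined modules. -/
theorem dual_posDet {t : Fin n → ℕ} {N : GrMod K n} (hN : PosDet K t N) :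
    PosDet K t ((dual K t).obj (op N)) := by
  obtain ⟨hN, hfd⟩ := posDet_iff.1 hN
  rw [(dualEval_isRealization t N).posDet_iff]
  refine ⟨fun a ha => eq_bot_iff.2 fun φ hφ => ?_, fun a i ha φ hφ => ?_, fun a => ?_⟩
  · obtain ⟨hφ, h⟩ := (mem_map_dualEval t N a φ).1 hφ
    refine hN.eq_zero_of_equivariant hφ (h _ fun h => ha fun i => ?_)
    have := h i
    simp only [Pi.sub_apply] at this
    simp only [Pi.zero_apply]
    omega
  · obtain ⟨hφ, h⟩ := (mem_map_dualEval t N _ φ).1 hφ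
    refine (mem_map_dualEval t N a φ).2 ⟨hφ, fun b hb x hx => ?_⟩
    by_cases hb0 : 0 ≤ b
    · refine h b (fun hb' => hb fun j => ?_) x hx
      by_cases hj : j = i
      · have := hb0 j
        subst hj
        simp only [Pi.sub_apply, Pi.zero_apply] at this ⊢
        omega
      · simpa [varDeg, hj] using hb' j
    · rw [hN.eq_bot b hb0, Submodule.mem_bot] at hx
      rw [hx, map_zero]
  · have := hfd fun i => t i
    refine FiniteDimensional.of_injective (V₂ := Module.Dual K (N.deg fun i => t i))
      ((N.deg fun i => t i).subtype.dualMap ∘ₗ Submodule.subtype _)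
      ((injective_iff_map_eq_zero _).2 fun φ h => Subtype.ext ?_)
    exact hN.eq_zero_of_equivariant ((mem_map_dualEval t N a _).1 φ.2).1
      fun x hx => LinearMap.congr_fun h ⟨x, hx⟩

/-! ### Comparison of duals and pullbacks -/

section comparison
variable (c : Fin n → ℕ) {q' : Deg n → Deg n} (hq' : MonotoneOn q' (Set.Ici 0))
  (q : (Fin n → ℕ) →o Deg n)

/-- Functionals on `M` restrict to functionals on `q^* M`, so the module obtained from `D_c M` by
reindexing along `q'` maps to the dual space of `q^* M`. -/
noncomputable def pullEval (M : GrMod K n) :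
    ((reindex 0 q' hq').obj ((dual K c).obj (op M))).carrier →ₗ[K]
      Module.Dual K ((pull q).obj M).carrier :=
  (pullUnderlying q M).dualMap ∘ₗ dualEval c M ∘ₗ underlying 0 q' hq' _

theorem pullEval_map {M N : GrMod K n} (u : M ⟶ N)
    (y : ((reindex 0 q' hq').obj ((dual K c).obj (op N))).carrier) :
    pullEval c hq' q M (Hom.lin ((reindex 0 q' hq').map ((dual K c).map u.op)) y) =
      pullEval c hq' q N y ∘ₗ (Hom.lin ((pull q).map u)).restrictScalars K := by
  refine LinearMap.ext fun x => ?_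
  change dualEval c M (underlying 0 q' hq' _ (Hom.lin _ y)) (pullUnderlying q M x) =
    dualEval c N (underlying 0 q' hq' _ y) (pullUnderlying q N (Hom.lin ((pull q).map u) x))
  rw [underlying_map, dualEval_map]
  exact congrArg (dualEval c N (underlying 0 q' hq' _ y))
    (underlying_map 0 _ (fun _ _ _ _ h => q.monotone fun i => Int.toNat_le_toNat (h i)) u x).symm

variable {q} {t : Fin n → ℕ}

theorem exists_pullUnderlying_top (hq1 : q 1 = fun i => (t i : ℤ)) {M : GrMod K n}
    {x : M.carrier} (hx : x ∈ M.deg fun i => t i) :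
    ∃ y ∈ ((pull q).obj M).deg 1, pullUnderlying q M y = x :=
  exists_pullUnderlying_eq q (b := 1) zero_le_one (hq1 ▸ hx)

theorem Determined.eq_zero_of_comp_pullUnderlying (hq1 : q 1 = fun i => (t i : ℤ))
    {M : GrMod K n} (hM : Determined t M) {φ : Module.Dual K M.carrier} (hφ : Equivariant φ)
    (h : φ ∘ₗ pullUnderlying q M = 0) : φ = 0 := by
  refine hM.eq_zero_of_equivariant hφ fun x hx => ?_
  obtain ⟨y, -, rfl⟩ := exists_pullUnderlying_top hq1 hx
  exact LinearMap.congr_fun h y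

/-- If `q^* M → M` identifies `(q^* M)_1` with `M_t`, then equivariant functionals on `M` and on
`q^* M` correspond, as both are the functionals on `M_t`. -/
theorem Determined.exists_comp_pullUnderlying (hq1 : q 1 = fun i => (t i : ℤ))
    (hq : ∀ b i, 1 ≤ b i → q (b + Pi.single i 1) = q b) {M : GrMod K n} (hM : Determined t M)
    {ψ : Module.Dual K ((pull q).obj M).carrier} (hψ : Equivariant ψ) :
    ∃ φ : Module.Dual K M.carrier, Equivariant φ ∧ φ ∘ₗ pullUnderlying q M = ψ := by
  have mem {y : ((pull q).obj M).carrier} (hy : y ∈ ((pull q).obj M).deg 1) :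
      pullUnderlying q M y ∈ M.deg fun i => t i := hq1 ▸ (pullUnderlying_mem q hy).1 zero_le_one
  let p : ((pull q).obj M).deg 1 →ₗ[K] M.deg fun i => t i :=
    (pullUnderlying q M).restrict fun y hy => mem hy
  have hp : Function.Bijective p := by
    refine ⟨fun x y e => Subtype.ext
      (eq_of_pullUnderlying_eq q x.2 y.2 (congrArg Subtype.val e)), fun x => ?_⟩
    obtain ⟨y, hy, e⟩ := exists_pullUnderlying_top hq1 x.2
    exact ⟨⟨y, hy⟩, Subtype.ext e⟩
  let e := LinearEquiv.ofBijective p hp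
  obtain ⟨φ, hφ, h⟩ := hM.exists_equivariant
    (ψ ∘ₗ (((pull q).obj M).deg 1).subtype ∘ₗ e.symm.toLinearMap)
  refine ⟨φ, hφ, sub_eq_zero.1 ?_⟩
  have hφ' : Equivariant (φ ∘ₗ pullUnderlying q M) := hφ.comp_underlying _ _ _
  refine (pull_determined hq M).eq_zero_of_equivariant (fun r x => ?_) fun y hy => ?_
  · rw [LinearMap.sub_apply, LinearMap.sub_apply, hφ', hψ, smul_sub]
  · have hy' : y ∈ ((pull q).obj M).deg 1 := hy
    have h1 : φ (pullUnderlying q M y) = ψ (e.symm (p ⟨y, hy'⟩)) := h (p ⟨y, hy'⟩)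
    rw [LinearMap.sub_apply, LinearMap.comp_apply, h1,
      show e.symm (p ⟨y, hy'⟩) = ⟨y, hy'⟩ from e.symm_apply_apply _, sub_self]

/-- For `t`-determined `M`, no equivariant functional is lost in passing from `M` to `q^* M`. -/
theorem pullEval_isRealization (hq1 : q 1 = fun i => (t i : ℤ)) {M : GrMod K n}
    (hM : Determined t M) : IsRealization (pullEval c hq' q M) where
  equivariant := (((dualEval_isRealization c M).comp_underlying 0 q' hq').equivariant).comp _
  injOn a x hx h := by
    have hr := (dualEval_isRealization c M).comp_underlying 0 q' hq'
    refine hr.injOn a x hx (hM.eq_zero_of_comp_pullUnderlying hq1 ?_ h)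
    have hx' := Submodule.mem_map_of_mem (f := underlying 0 q' hq' _) hx
    rw [map_underlying] at hx'
    by_cases ha : 0 ≤ a
    · exact ((mem_map_dualEval c M _ _).1 (Submodule.mem_map_of_mem (hx'.1 ha))).1
    · intro r y
      rw [LinearMap.comp_apply, hx'.2 ha, map_zero]
      exact (smul_zero _).symm

/-- The reindexed module `D_c M` and the module `D_1 (q^* M)` are the same family of subspaces of the
dual space of `q^* M`. The hypotheses `h₁`, `h₂` and `h₃` say that, in degree `a`, the vanishing
conditions on the functionals on both sides agree: `h₁` covers the conditions on `q^* M`, and by `h₂`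
and `h₃` the conditions on `M` all follow from those in the degrees `q(1 - e_i)` with `a_i = 0`. -/
theorem map_pullEval (hq1 : q 1 = fun i => (t i : ℤ))
    (hq : ∀ b i, 1 ≤ b i → q (b + Pi.single i 1) = q b)
    (h₁ : ∀ a b : Deg n, 0 ≤ a → 0 ≤ b → ¬ 1 - a ≤ b →
      ¬ (fun i => (c i : ℤ)) - q' a ≤ q fun i => (b i).toNat)
    (h₂ : ∀ a b : Deg n, 0 ≤ a → 0 ≤ b → ¬ (fun i => (c i : ℤ)) - q' a ≤ b →
      ∃ i, a i = 0 ∧ b i ≤ q (Function.update 1 i 0) i)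
    (h₃ : ∀ i j, j ≠ i → q (Function.update 1 i 0) j = t j)
    {M : GrMod K n} (hM : PosDet K t M) (a : Deg n) :
    (((reindex 0 q' hq').obj ((dual K c).obj (op M))).deg a).map (pullEval c hq' q M) =
      (((dual K 1).obj (op ((pull q).obj M))).deg a).map (dualEval 1 ((pull q).obj M)) := by
  obtain ⟨hM, hfd⟩ := posDet_iff.1 hM
  rw [pullEval, Submodule.map_comp, Submodule.map_comp, map_underlying]
  by_cases ha : 0 ≤ a
  -- Both sides vanish in degrees `a` that are not nonnegative, so let `a ≥ 0` first.
  · rw [reindexDeg_of_le _ _ ha]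
    ext ψ
    rw [mem_map_dualEval]
    change _ ↔ Equivariant ψ ∧ ∀ b, ¬ 1 - a ≤ b → _
    constructor
    · rintro ⟨φ, hφ, rfl⟩
      obtain ⟨hφ, h⟩ := (mem_map_dualEval c M _ φ).1 hφ
      refine ⟨hφ.comp_underlying _ _ _, fun b hb y hy => ?_⟩
      change φ (pullUnderlying q M y) = 0
      by_cases hb0 : 0 ≤ b
      · exact h _ (h₁ a b ha hb0 hb) _ ((pullUnderlying_mem q hy).1 hb0)
      · rw [(pullUnderlying_mem q hy).2 hb0, map_zero]
    · rintro ⟨hψ, h⟩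
      obtain ⟨φ, hφ, rfl⟩ := hM.exists_comp_pullUnderlying hq1 hq hψ
      refine ⟨φ, (mem_map_dualEval c M _ φ).2 ⟨hφ, fun b hb x hx => ?_⟩, rfl⟩
      by_cases hb0 : 0 ≤ b
      · obtain ⟨i, hai, hbi⟩ := h₂ a b ha hb0 hb
        -- Take `d = q(1 - e_i)`. As `b_i ≤ d_i` and `d_j = t_j` for `j ≠ i`, the map `M_d → M_{b ⊔ d}`
        -- is surjective, so the vanishing of `φ` on `M_d` implies that on `M_b`.
        set d : Deg n := q (Function.update 1 i 0) with hd
        obtain ⟨y, hy, e⟩ := hM.exists_mono_smul_eq (a := d) (b := b ⊔ d) le_sup_right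
          (fun j hj => by
            by_cases hji : j = i
            · subst hji
              exact absurd hj (by simpa using hbi)
            · exact (h₃ i j hji).ge) (M.mono_smul_mem le_sup_left hx)
        rw [← hφ.mono_smul, ← e, hφ.mono_smul]
        have hq0 : (q fun j => ((Function.update 1 i 0 : Deg n) j).toNat) = d := by
          rw [hd]
          congr 1
          ext j
          by_cases hji : j = i
          · subst hji; simp
          · simp [hji]
        obtain ⟨z, hz, rfl⟩ := exists_pullUnderlying_eq q (M := M)
          (b := Function.update 1 i 0) (fun j => by
            by_cases hji : j = i
            · subst hji; simp
            · simp [hji]) (hq0 ▸ hy)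
        refine h _ (fun hle => ?_) z hz
        have := hle i
        simp [hai] at this
      · rw [hM.eq_bot b hb0, Submodule.mem_bot] at hx
        rw [hx, map_zero]
  · have hpos : PosDet K 1 ((pull q).obj M) :=
      posDet_iff.2 ⟨pull_determined hq M, pull_finiteDimensional hfd⟩
    rw [reindexDeg_of_not_le _ _ ha, (dual_posDet hpos).2.1 a ha]
    simp only [Submodule.map_bot]

/-- The functor `D_c` followed by the reindexing along `q'` is isomorphic to `D_1 ∘ q^*` on positively
`t`-determined modules, under the combinatorial conditions of `map_pullEval`. -/
theorem exists_natIso (hq1 : q 1 = fun i => (t i : ℤ))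
    (hq : ∀ b i, 1 ≤ b i → q (b + Pi.single i 1) = q b)
    (h₁ : ∀ a b : Deg n, 0 ≤ a → 0 ≤ b → ¬ 1 - a ≤ b →
      ¬ (fun i => (c i : ℤ)) - q' a ≤ q fun i => (b i).toNat)
    (h₂ : ∀ a b : Deg n, 0 ≤ a → 0 ≤ b → ¬ (fun i => (c i : ℤ)) - q' a ≤ b →
      ∃ i, a i = 0 ∧ b i ≤ q (Function.update 1 i 0) i)
    (h₃ : ∀ i j, j ≠ i → q (Function.update 1 i 0) j = t j) :
    ∃ (h : ∀ M, PosDet K 1 (((inclT K t).op ⋙ dual K c ⋙ reindex 0 q' hq').obj M))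
      (h' : ∀ M, PosDet K 1 (((inclT K t ⋙ pull q).op ⋙ dual K 1).obj M)),
      Nonempty ((PosDet K 1).lift ((inclT K t).op ⋙ dual K c ⋙ reindex 0 q' hq') h ≅
        (PosDet K 1).lift ((inclT K t ⋙ pull q).op ⋙ dual K 1) h') := by
  have hρ {M : GrMod K n} (hM : PosDet K t M) : IsRealization (pullEval c hq' q M) :=
    pullEval_isRealization c hq' hq1 (posDet_iff.1 hM).1
  have hσ (M : GrMod K n) := dualEval_isRealization 1 ((pull q).obj M)
  have hmap {M : GrMod K n} (hM : PosDet K t M) (a : Deg n) :=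
    map_pullEval c hq' hq1 hq h₁ h₂ h₃ hM a
  have hG {M : GrMod K n} (hM : PosDet K t M) :
      PosDet K 1 ((dual K 1).obj (op ((pull q).obj M))) :=
    dual_posDet (posDet_iff.2
      ⟨pull_determined hq M, pull_finiteDimensional (posDet_iff.1 hM).2⟩)
  have hF {M : GrMod K n} (hM : PosDet K t M) :
      PosDet K 1 ((reindex 0 q' hq').obj ((dual K c).obj (op M))) := by
    obtain ⟨h0, hX, hfd⟩ := ((hσ M).posDet_iff 1).1 (hG hM)
    refine ((hρ hM).posDet_iff 1).2 ⟨fun a ha => (hmap hM a).trans (h0 a ha), fun a i ha => ?_,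
      fun a => ?_⟩
    · rw [hmap hM, hmap hM]
      exact hX a i ha
    · rw [hmap hM]
      exact hfd a
  choose e he using fun M : ModT K t => (hρ M.property).exists_iso (hσ M.obj) (hmap M.property)
  refine ⟨fun M => hF M.unop.property, fun M => hG M.unop.property,
    ⟨NatIso.ofComponents (fun M => (PosDet K 1).isoMk (e M.unop)) fun {M N} u => ?_⟩⟩
  refine ObjectProperty.hom_ext _ ((hσ N.unop.obj).hom_ext fun x => ?_)
  have hl := (he N.unop _).trans (pullEval_map c hq' q u.unop.hom x)
  have hr := (dualEval_map 1 ((pull q).map u.unop.hom) (Hom.lin (e M.unop).hom x)).trans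
    (congrArg (· ∘ₗ _) (he M.unop x))
  exact hl.trans hr.symm

end comparison

theorem rMap_apply (t a : Fin n → ℕ) (i : Fin n) :
    rMap t a i = if 0 < a i then (t i : ℤ) else 0 := rfl

theorem sMap_apply (t a : Fin n → ℕ) (i : Fin n) :
    sMap t a i = if 1 ≤ a i then (t i : ℤ) else (t i : ℤ) - 1 := rfl

end GrMod
end MultiGr

open MultiGr MultiGr.GrMod in
theorem proposition2p2 {K : Type u} [Field K] {n : ℕ} (t : Fin n → ℕ) (ht : ∀ i, 1 ≤ t i) :
    (∃ (h : ∀ M, PosDet K 1 (((inclT K t).op ⋙ dual K 1 ⋙ tau 0).obj M))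
       (h' : ∀ M, PosDet K 1 (((inclT K t ⋙ rStar t).op ⋙ dual K 1).obj M)),
       Nonempty ((PosDet K 1).lift ((inclT K t).op ⋙ dual K 1 ⋙ tau 0) h ≅
         (PosDet K 1).lift ((inclT K t ⋙ rStar t).op ⋙ dual K 1) h')) ∧
    (∃ (h : ∀ M, PosDet K 1 (((inclT K t).op ⋙ dual K t ⋙ rStar t).obj M))
       (h' : ∀ M, PosDet K 1 (((inclT K t ⋙ sStar t).op ⋙ dual K 1).obj M)),
       Nonempty ((PosDet K 1).lift ((inclT K t).op ⋙ dual K t ⋙ rStar t) h ≅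
         (PosDet K 1).lift ((inclT K t ⋙ sStar t).op ⋙ dual K 1) h')) := by
  have le_iff (a b : Deg n) : ¬ a ≤ b ↔ ∃ i, b i < a i := by simp [Pi.le_def]
  constructor
  · refine exists_natIso 1 _ ?_ ?_ ?_ ?_ ?_
    · ext i
      simp [rMap_apply]
    · intro b i hb
      ext j
      by_cases h : j = i
      · subst h
        simp [rMap_apply, show 0 < b j by omega]
      · simp [rMap_apply, h]
    · intro a b ha hb h
      rw [le_iff] at h ⊢
      obtain ⟨i, hi⟩ := h
      have h1 := ha i
      have h2 := hb i
      refine ⟨i, ?_⟩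
      simp [rMap_apply] at hi h1 h2 ⊢
      split_ifs <;> omega
    · intro a b ha hb h
      rw [le_iff] at h
      obtain ⟨i, hi⟩ := h
      have h1 := ha i
      have h2 := hb i
      refine ⟨i, ?_⟩
      simp [rMap_apply] at hi h1 h2 ⊢
      omega
    · intro i j h
      simp [rMap_apply, h]
  · refine exists_natIso t _ ?_ ?_ ?_ ?_ ?_
    · ext i
      simp [sMap_apply]
    · intro b i hb
      ext j
      by_cases h : j = i
      · subst h
        simp [sMap_apply, show 1 ≤ b j by omega]
      · simp [sMap_apply, h]
    · intro a b ha hb h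
      rw [le_iff] at h ⊢
      obtain ⟨i, hi⟩ := h
      have h1 := ha i
      have h2 := hb i
      have h3 := ht i
      refine ⟨i, ?_⟩
      simp [rMap_apply, sMap_apply] at hi h1 h2 ⊢
      split_ifs <;> omega
    · intro a b ha hb h
      rw [le_iff] at h
      obtain ⟨i, hi⟩ := h
      have h1 := ha i
      have h2 := hb i
      refine ⟨i, ?_⟩
      simp [rMap_apply, sMap_apply] at hi h1 h2 ⊢
      split_ifs at hi <;> omega
    · intro i j h
      simp [sMap_apply, h]
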